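/- For each $N\ge 1$ let $E_N$ be a finite set and $(\mathbb P^N_\eta)_{\eta\in E_N}$ an irreducible continuous-time Markov process on the càdlàg path space $D(\mathbb R_+,E_N)$ with generator $(L_Nf)(\eta)=\sum_{\xi\in E_N}\{f(\xi)-f(\eta)\}R_N(\eta,\xi)$ and coordinate process $\eta^N_t$. Fix $\kappa\ge 1$, let $S=\{1,\dots,\kappa\}$, and for each $N$ let $\mathcal E^x_N\subseteq E_N$, $x\in S$, be pairwise disjoint. Set $\mathcal E_N=\bigcup_{x\in S}\mathcal E^x_N$, $\Delta_N=E_N\setminus\mathcal E_N$, and $\Psi_N(\eta)=x$ for $\eta\in\mathcal E^x_N$. For $F\subseteq E_N$ let $\mathcal T^F_t=\int_0^t\mathbf 1\{\eta^N_s\in F\}\,ds$ and $\mathcal S^F_t=\sup\{s\ge 0:\mathcal T^F_s\le t\}$. For a starting point in $\mathcal E_N$, the trace process on $\mathcal E_N$ is $\eta^{\mathcal E_N}_t=\eta^N_{\mathcal S^{\mathcal E_N}_t}$; put $X^N_t=\Psi_N(\eta^{\mathcal E_N}_t)$. Let $(\mathbb Q_x)_{x\in S}$ be a Markov process on $D(\mathbb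 R_+,S)$. The sequence $(\eta^N_t)_{N\ge1}$ is called meta-stable with meta-states $(\mathcal E^x_N)_{x\in S}$ and limit $(\mathbb Q_x)_{x\in S}$ if (A) for every $x\in S$ and every sequence $\eta_N\in\mathcal E^x_N$, $N\ge1$, the law of $X^N$ under $\mathbb P^N_{\eta_N}$ converges weakly to $\mathbb Q_x$ on $D(\mathbb R_+,S)$ with the Skorohod topology; (B) for every $t>0$, $\lim_{N\to\infty}\max_{\eta\in\mathcal E_N}\mathbb E^N_\eta[\mathcal T^{\Delta_N}_t]=0$. For a path started in $\mathcal E_N$ let $\sigma(t)=\sup\{s\le t:\eta^N_s\in\mathcal E_N\}$, and let $\hat X^N_t=\Psi_N(\eta^N_{\sigma(t)})$ if $\eta^N_{\sigma(t)}\in\mathcal E_N$ and $\hat X^N_t=\Psi_N(\eta^N_{\sigma(t)-})$ (left limit) otherwise; that is, $\hat X^N_t$ is the image under $\Psi_N$ of the last point of $\mathcal E_N$ visited up to time $t$. Proposition. If $(\eta^N_t)_{N\ge1}$ is meta-stable with meta-states $(\mathcal E^x_N)_{x\in S}$ and limit $(\mathbb Q_x)_{x\in S}$, then for every $x\in S$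 and every sequence $\eta_N\in\mathcal E^x_N$, $N\ge1$, the law of $\hat X^N$ under $\mathbb P^N_{\eta_N}$ converges weakly to $\mathbb Q_x$ on $D(\mathbb R_+,S)$ with the Skorohod topology. -/

import Mathlib

open MeasureTheory ProbabilityTheory Set Filter Topology
open scoped NNReal ENNReal Uniformity

/-! ### Càdlàg paths and the path space `D(ℝ₊, E)` -/

/-- `f : ℝ₊ → E` is right-continuous with left limits. -/
def IsCadlag {E : Type*} [TopologicalSpace E] (f : ℝ≥0 → E) : Prop :=
  (∀ t, ContinuousWithinAt f (Ici t) t) ∧ ∀ t, ∃ l, Tendsto f (𝓝[<] t) (𝓝 l)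

/-- The path space `D(ℝ₊, E)`. -/
def PathSpace (E : Type*) [TopologicalSpace E] : Type _ := {f : ℝ≥0 → E // IsCadlag f}

namespace PathSpace

section basic

variable {E : Type*} [TopologicalSpace E]

instance : CoeFun (PathSpace E) (fun _ => ℝ≥0 → E) := ⟨Subtype.val⟩

theorem isCadlag_const (x : E) : IsCadlag (fun _ : ℝ≥0 => x) :=
  ⟨fun _ => continuousWithinAt_const, fun _ => ⟨x, tendsto_const_nhds⟩⟩

theorem isCadlag_shift (ω : PathSpace E) (s : ℝ≥0) : IsCadlag (fun t => ω (s + t)) := by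
  refine ⟨fun t => ?_, fun t => ?_⟩
  · have h := ω.2.1 (s + t)
    exact ContinuousWithinAt.comp (t := Ici (s + t)) h (by fun_prop)
      (fun u hu => add_le_add_right hu s)
  · obtain ⟨l, hl⟩ := ω.2.2 (s + t)
    refine ⟨l, hl.comp ?_⟩
    refine tendsto_nhdsWithin_iff.2 ⟨?_, ?_⟩
    · exact ((continuous_const.add continuous_id).tendsto t).mono_left nhdsWithin_le_nhds
    · filter_upwards [self_mem_nhdsWithin] with u hu
      exact (add_lt_add_iff_left s).2 hu

/-- The time shift `(θ_s ω)(t) = ω(s + t)`. -/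
def shift (s : ℝ≥0) (ω : PathSpace E) : PathSpace E := ⟨fun t => ω (s + t), isCadlag_shift ω s⟩

open Classical in
/-- The function `f` as an element of the path space. It is applied below to functions of a path
that are càdlàg almost surely; if `f` is not càdlàg the value is a constant path. -/
noncomputable def ofFun (f : ℝ≥0 → E) : PathSpace E :=
  if h : IsCadlag f then ⟨f, h⟩ else ⟨fun _ => f 0, isCadlag_const _⟩

/-- The σ-algebra on the path space generated by the coordinate maps `ω ↦ ω t`. -/
instance : MeasurableSpace (PathSpace E) :=
  ⨆ t : ℝ≥0, (borel E).comap (fun ω : PathSpace E => ω t)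

/-- The σ-algebra `σ(ω r : r ≤ s)`. -/
abbrev past (E : Type*) [TopologicalSpace E] (s : ℝ≥0) : MeasurableSpace (PathSpace E) :=
  ⨆ r : ℝ≥0, ⨆ _ : r ≤ s, (borel E).comap (fun ω : PathSpace E => ω r)

/-- The pairs of paths `(ω, ω')` for which some time change `l`, an increasing bijection of `ℝ₊`
that is `ε`-close to the identity on `[0, M]`, satisfies `ω' (l t) = ω t` for all `t ≤ M`. -/
def closePairs (E : Type*) [TopologicalSpace E] (M : ℝ≥0) (ε : ℝ) :
    Set (PathSpace E × PathSpace E) :=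
  {p | ∃ l : ℝ≥0 ≃o ℝ≥0, ∀ t ≤ M, |(l t : ℝ) - t| < ε ∧ p.2 (l t) = p.1 t}

theorem closePairs_mono {M M' : ℝ≥0} {ε ε' : ℝ} (hM : M' ≤ M) (hε : ε ≤ ε') :
    closePairs E M ε ⊆ closePairs E M' ε' := by
  rintro p ⟨l, hl⟩
  exact ⟨l, fun t ht => ⟨(hl t (ht.trans hM)).1.trans_le hε, (hl t (ht.trans hM)).2⟩⟩

theorem closePairs_refl (M : ℝ≥0) {ε : ℝ} (hε : 0 < ε) (ω : PathSpace E) :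
    (ω, ω) ∈ closePairs E M ε := ⟨OrderIso.refl _, fun t _ => by simpa using hε⟩

theorem closePairs_symm (M : ℝ≥0) {ε : ℝ} (hε : ε ≤ 1) {p : PathSpace E × PathSpace E}
    (hp : p ∈ closePairs E (M + 1) ε) : p.swap ∈ closePairs E M ε := by
  obtain ⟨l, hl⟩ := hp
  refine ⟨l.symm, fun t ht => ?_⟩
  have h1 : l.symm t ≤ M + 1 := by
    rw [OrderIso.symm_apply_le]
    have := (abs_lt.1 (hl (M + 1) le_rfl).1).1
    push_cast at this
    have ht' : (t : ℝ) ≤ M := by exact_mod_cast ht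
    exact_mod_cast (by linarith : (t : ℝ) ≤ l (M + 1))
  have h2 := hl _ h1
  rw [OrderIso.apply_symm_apply] at h2
  exact ⟨by rw [abs_sub_comm]; exact h2.1, h2.2.symm⟩

theorem closePairs_comp (M : ℝ≥0) {ε : ℝ} (hε : ε ≤ 1) {ω₁ ω₂ ω₃ : PathSpace E}
    (h₁ : (ω₁, ω₂) ∈ closePairs E (M + 1) (ε / 2)) (h₂ : (ω₂, ω₃) ∈ closePairs E (M + 1) (ε / 2)) :
    (ω₁, ω₃) ∈ closePairs E M ε := by
  obtain ⟨l, hl⟩ := h₁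
  obtain ⟨k, hk⟩ := h₂
  refine ⟨l.trans k, fun t ht => ?_⟩
  have ht' : (t : ℝ) ≤ M := by exact_mod_cast ht
  obtain ⟨a1, a2⟩ := hl t (ht.trans (by simp))
  have b : l t ≤ M + 1 := by
    have := (abs_lt.1 a1).2
    exact_mod_cast (by linarith : (l t : ℝ) ≤ M + 1)
  obtain ⟨b1, b2⟩ := hk _ b
  refine ⟨?_, b2.trans a2⟩
  have := abs_add_le ((k (l t) : ℝ) - l t) ((l t : ℝ) - t)
  simp only [OrderIso.trans_apply]
  rw [sub_add_sub_cancel] at this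
  linarith

/-- The sets `closePairs E M ε` form a basis of the Skorohod uniformity. -/
def skorohodBasis (E : Type*) [TopologicalSpace E] : FilterBasis (PathSpace E × PathSpace E) where
  sets := {s | ∃ M : ℝ≥0, ∃ ε : ℝ, 0 < ε ∧ s = closePairs E M ε}
  nonempty := ⟨_, 0, 1, one_pos, rfl⟩
  inter_sets := by
    rintro _ _ ⟨M, ε, hε, rfl⟩ ⟨M', ε', hε', rfl⟩
    exact ⟨_, ⟨max M M', min ε ε', lt_min hε hε', rfl⟩,
      subset_inter (closePairs_mono (le_max_left _ _) (min_le_left _ _))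
        (closePairs_mono (le_max_right _ _) (min_le_right _ _))⟩

/-- The Skorohod (J1) topology on `D(ℝ₊, E)` for a discrete space `E`, together with its natural
uniformity: `ω_n → ω` if and only if there are increasing bijections `l_n` of `ℝ₊` such that, for
every `M`, `sup_{t ≤ M} |l_n t - t| → 0` and `ω_n (l_n t) = ω t` for all `t ≤ M` and all large `n`
(for a discrete `E`, uniform closeness of `ω_n ∘ l_n` to `ω` on `[0, M]` means equality). -/
instance [DiscreteTopology E] : UniformSpace (PathSpace E) :=
  UniformSpace.ofCore <| UniformSpace.Core.mkOfBasis (skorohodBasis E)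
    (by
      rintro _ ⟨M, ε, hε, rfl⟩ ω
      exact closePairs_refl M hε ω)
    (by
      rintro _ ⟨M, ε, hε, rfl⟩
      refine ⟨_, ⟨M + 1, min ε 1, lt_min hε one_pos, rfl⟩, fun p hp => ?_⟩
      exact closePairs_mono le_rfl (min_le_left _ _) (closePairs_symm M (min_le_right _ _) hp))
    (by
      rintro _ ⟨M, ε, hε, rfl⟩
      refine ⟨_, ⟨M + 1, min ε 1 / 2, half_pos (lt_min hε one_pos), rfl⟩, ?_⟩
      rintro ⟨ω₁, ω₃⟩ ⟨ω₂, h₁, h₂⟩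
      exact closePairs_mono le_rfl (min_le_left _ _) (closePairs_comp M (min_le_right _ _) h₁ h₂))

theorem isCadlag_step (m : ℕ) (g : ℕ → E) : IsCadlag (fun t : ℝ≥0 => g ⌊(m : ℝ≥0) * t⌋₊) := by
  have hcont : Continuous fun t : ℝ≥0 => (m : ℝ≥0) * t := by fun_prop
  refine ⟨fun t => ?_, fun t => ?_⟩
  · refine ContinuousWithinAt.congr_of_eventuallyEq
      (continuousWithinAt_const (b := g ⌊(m : ℝ≥0) * t⌋₊)) ?_ rfl
    have h1 : ∀ᶠ s in 𝓝[≥] t, (m : ℝ≥0) * s < (⌊(m : ℝ≥0) * t⌋₊ : ℝ≥0) + 1 :=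
      (hcont.tendsto t).mono_left nhdsWithin_le_nhds (Iio_mem_nhds (Nat.lt_floor_add_one _))
    filter_upwards [h1, self_mem_nhdsWithin] with s hs hs'
    congr 1
    refine (Nat.floor_eq_iff zero_le).2 ⟨?_, hs⟩
    exact (Nat.floor_le zero_le).trans (mul_le_mul_right hs' _)
  · refine ⟨g (⌈(m : ℝ≥0) * t⌉₊ - 1), ?_⟩
    refine tendsto_nhds_of_eventually_eq ?_
    rcases Nat.eq_zero_or_pos m with rfl | hm
    · simp
    rcases eq_or_ne t 0 with rfl | ht
    · simp
    have hpos : 0 < (m : ℝ≥0) * t := mul_pos (by exact_mod_cast hm) (pos_iff_ne_zero.2 ht)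
    have hc1 : 1 ≤ ⌈(m : ℝ≥0) * t⌉₊ := Nat.one_le_iff_ne_zero.2 (Nat.ceil_pos.2 hpos).ne'
    have hlt : ((⌈(m : ℝ≥0) * t⌉₊ - 1 : ℕ) : ℝ≥0) < m * t := Nat.lt_ceil.1 (by omega)
    have h1 : ∀ᶠ s in 𝓝[<] t, ((⌈(m : ℝ≥0) * t⌉₊ - 1 : ℕ) : ℝ≥0) < m * s :=
      (hcont.tendsto t).mono_left nhdsWithin_le_nhds (Ioi_mem_nhds hlt)
    filter_upwards [h1, self_mem_nhdsWithin] with s hs hs'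
    congr 1
    refine (Nat.floor_eq_iff zero_le).2 ⟨hs.le, ?_⟩
    have : (m : ℝ≥0) * s < m * t := mul_lt_mul_of_pos_left hs' (by exact_mod_cast hm)
    have h2 := this.trans_le (Nat.le_ceil _)
    have h3 : ((⌈(m : ℝ≥0) * t⌉₊ - 1 : ℕ) : ℝ≥0) + 1 = (⌈(m : ℝ≥0) * t⌉₊ : ℝ≥0) := by
      exact_mod_cast (by omega : ⌈(m : ℝ≥0) * t⌉₊ - 1 + 1 = ⌈(m : ℝ≥0) * t⌉₊)
    rwa [h3]

/-- The step path with the values `g k` on `[k / m, (k + 1) / m)`, frozen after time `m`. -/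
noncomputable def stepPath (m : ℕ) (g : ℕ → E) : PathSpace E :=
  ⟨fun t => g (min ⌊(m : ℝ≥0) * t⌋₊ (m * m)), isCadlag_step m fun k => g (min k (m * m))⟩

end basic

section borel

variable {E : Type*} [TopologicalSpace E] [DiscreteTopology E]

theorem hasBasis_uniformity :
    (𝓤 (PathSpace E)).HasBasis (fun p : ℝ≥0 × ℝ => 0 < p.2) (fun p => closePairs E p.1 p.2) := by
  refine ⟨fun s => ?_⟩
  refine (skorohodBasis E).mem_filter_iff.trans ⟨?_, ?_⟩
  · rintro ⟨_, ⟨M, ε, hε, rfl⟩, h⟩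
    exact ⟨(M, ε), hε, h⟩
  · rintro ⟨⟨M, ε⟩, hε, h⟩
    exact ⟨_, ⟨M, ε, hε, rfl⟩, h⟩

instance : (𝓤 (PathSpace E)).IsCountablyGenerated := by
  refine HasCountableBasis.isCountablyGenerated (ι := ℕ) (p := fun _ => True)
    (s := fun n => closePairs E n (1 / ((n : ℝ) + 1))) ⟨?_, to_countable _⟩
  refine hasBasis_uniformity.to_hasBasis ?_ ?_
  · rintro ⟨M, ε⟩ hε
    obtain ⟨n, hn⟩ := exists_nat_ge M
    obtain ⟨m, hm⟩ := exists_nat_one_div_lt (show 0 < ε from hε)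
    refine ⟨max n m, trivial, closePairs_mono (hn.trans (by simp)) ?_⟩
    refine le_trans (one_div_le_one_div_of_le (by positivity) ?_) hm.le
    simp
  · intro n _
    exact ⟨(n, 1 / ((n : ℝ) + 1)), by positivity, subset_rfl⟩

/-- Induction along a path with values in a discrete space. -/
theorem cadlag_induction (ω : PathSpace E) {p : ℝ≥0 → Prop} (h0 : p 0)
    (hstep : ∀ a b, a < b → p a → (∀ t, a ≤ t → t < b → ω t = ω a) → p b) (T : ℝ≥0) : p T := by
  by_contra hT
  set A : Set ℝ≥0 := {a | a ≤ T ∧ p a} with hA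
  have hAne : A.Nonempty := ⟨0, zero_le, h0⟩
  have hAb : BddAbove A := ⟨T, fun a ha => ha.1⟩
  have hsT : sSup A ≤ T := csSup_le hAne fun a ha => ha.1
  have hps : p (sSup A) := by
    obtain ⟨l, hl⟩ := ω.2.2 (sSup A)
    by_contra hns
    have hev : ∀ᶠ t in 𝓝[<] (sSup A), ω t = l := by
      exact hl ((isOpen_discrete {l}).mem_nhds rfl)
    obtain ⟨a0, ha0⟩ := hAne
    have hlt : ∀ a ∈ A, a < sSup A := fun a ha =>
      lt_of_le_of_ne (le_csSup hAb ha) (fun h => hns (h ▸ ha.2))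
    obtain ⟨c, hc, hcs⟩ := (mem_nhdsLT_iff_exists_Ioo_subset' (hlt a0 ha0)).1 hev
    obtain ⟨a, ha, hca⟩ := exists_lt_of_lt_csSup ⟨a0, ha0⟩ hc
    refine hns (hstep a _ (hlt a ha) ha.2 fun t h1 h2 => ?_)
    have e1 : ω t = l := hcs ⟨hca.trans_le h1, h2⟩
    have e2 : ω a = l := hcs ⟨hca, hlt a ha⟩
    rw [e1, e2]
  have hlt : sSup A < T := lt_of_le_of_ne hsT (fun h => hT (h ▸ hps))
  have hev : ∀ᶠ t in 𝓝[≥] (sSup A), ω t = ω (sSup A) := by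
    exact ω.2.1 (sSup A) ((isOpen_discrete {ω (sSup A)}).mem_nhds rfl)
  obtain ⟨c, hc, hcs⟩ := (mem_nhdsGE_iff_exists_Ico_subset' hlt).1 hev
  have hmin : sSup A < min c T := lt_min hc hlt
  have : p (min c T) := hstep _ _ hmin hps fun t h1 h2 =>
    hcs ⟨h1, h2.trans_le (min_le_left _ _)⟩
  exact absurd (le_csSup hAb ⟨min_le_right _ _, this⟩) (not_le.2 hmin)

/-- Replace an order isomorphism by an affine map to the right of a point. -/
theorem exists_glue (l : ℝ≥0 ≃o ℝ≥0) (a : ℝ≥0) {c : ℝ≥0} (hc : 0 < c) :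
    ∃ l' : ℝ≥0 ≃o ℝ≥0, (∀ t ≤ a, l' t = l t) ∧ ∀ t, a ≤ t → l' t = l a + c * (t - a) := by
  let f : ℝ≥0 → ℝ≥0 := fun t => if t ≤ a then l t else l a + c * (t - a)
  have f1 : ∀ t ≤ a, f t = l t := fun t ht => if_pos ht
  have f2 : ∀ t, a ≤ t → f t = l a + c * (t - a) := by
    intro t ht
    rcases ht.eq_or_lt with rfl | h
    · simp [f]
    · exact if_neg (not_le.2 h)
  have hmono : StrictMono f := by
    intro s t hst
    rcases le_total t a with h | h
    · rw [f1 t h, f1 s (hst.le.trans h)]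
      exact l.strictMono hst
    · rcases le_total s a with h' | h'
      · rw [f1 s h', f2 t h]
        rcases h.eq_or_lt with rfl | h2
        · simpa using hst
        · exact (l.monotone h').trans_lt (lt_add_of_pos_right _ (mul_pos hc (tsub_pos_of_lt h2)))
      · rw [f2 s h', f2 t h]
        exact add_lt_add_right (mul_lt_mul_of_pos_left (tsub_lt_tsub_right_of_le h' hst) hc) _
  have hsurj : Function.Surjective f := by
    intro y
    rcases le_total y (l a) with h | h
    · refine ⟨l.symm y, ?_⟩
      rw [f1 _ (by rwa [OrderIso.symm_apply_le]), OrderIso.apply_symm_apply]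
    · refine ⟨a + (y - l a) / c, ?_⟩
      rw [f2 _ (by simp), add_tsub_cancel_left, mul_div_cancel₀ _ hc.ne', add_tsub_cancel_of_le h]
  exact ⟨hmono.orderIsoOfSurjective f hsurj, f1, f2⟩

theorem eventually_close_stepPath (ω : PathSpace E) (M : ℝ≥0) {ε : ℝ} (hε : 0 < ε) :
    ∀ᶠ m : ℕ in atTop, (ω, stepPath m fun k => ω (k / m)) ∈ closePairs E M ε := by
  have key : ∀ᶠ m : ℕ in atTop, ∃ l : ℝ≥0 ≃o ℝ≥0, (l (M + 1) : ℝ) = ⌈(m : ℝ≥0) * (M + 1)⌉₊ / m ∧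
      ∀ t < M + 1, (t : ℝ) ≤ l t ∧ (l t : ℝ) ≤ t + 1 / m ∧ ω (⌊(m : ℝ≥0) * l t⌋₊ / m) = ω t := by
    refine cadlag_induction ω (p := fun T => ∀ᶠ m : ℕ in atTop, ∃ l : ℝ≥0 ≃o ℝ≥0,
      (l T : ℝ) = ⌈(m : ℝ≥0) * T⌉₊ / m ∧
      ∀ t < T, (t : ℝ) ≤ l t ∧ (l t : ℝ) ≤ t + 1 / m ∧ ω (⌊(m : ℝ≥0) * l t⌋₊ / m) = ω t) ?_ ?_ _
    · exact Eventually.of_forall fun m => ⟨OrderIso.refl _, by simp, fun t ht => by simp at ht⟩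
    · intro a b hab ha hconst
      have hab' : (0 : ℝ) < (b : ℝ) - a := sub_pos.2 (by exact_mod_cast hab)
      obtain ⟨m₀, hm₀⟩ := exists_nat_gt (1 / ((b : ℝ) - a))
      filter_upwards [ha, eventually_ge_atTop m₀, eventually_gt_atTop 0] with m hm hmm hmpos
      obtain ⟨l, hl, hlt⟩ := hm
      have hmR : (0 : ℝ) < m := by exact_mod_cast hmpos
      have hm1 : 1 < (m : ℝ) * ((b : ℝ) - a) := by
        have : (m₀ : ℝ) ≤ m := by exact_mod_cast hmm
        have := hm₀.trans_le this
        rwa [div_lt_iff₀ hab'] at this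
      set A := ⌈(m : ℝ≥0) * a⌉₊ with hA
      set B := ⌈(m : ℝ≥0) * b⌉₊ with hB
      have hA1 : (m : ℝ) * a ≤ A := by exact_mod_cast Nat.le_ceil ((m : ℝ≥0) * a)
      have hB1 : (m : ℝ) * b ≤ B := by exact_mod_cast Nat.le_ceil ((m : ℝ≥0) * b)
      have hA2 : (A : ℝ) < m * a + 1 := by
        exact_mod_cast Nat.ceil_lt_add_one (zero_le (a := (m : ℝ≥0) * a))
      have hB2 : (B : ℝ) < m * b + 1 := by
        exact_mod_cast Nat.ceil_lt_add_one (zero_le (a := (m : ℝ≥0) * b))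
      have hAB : (A : ℝ) < B := by nlinarith
      have hc : (0 : ℝ) < ((B : ℝ) - A) / m / (b - a) :=
        div_pos (div_pos (by linarith) hmR) hab'
      obtain ⟨l', h1, h2⟩ := exists_glue l a (c := Real.toNNReal (((B : ℝ) - A) / m / (b - a)))
        (Real.toNNReal_pos.2 hc)
      have h2' : ∀ t, a ≤ t → (l' t : ℝ) = A / m + ((B : ℝ) - A) / m / (b - a) * (t - a) := by
        intro t ht
        rw [h2 t ht]
        rw [NNReal.coe_add, NNReal.coe_mul, NNReal.coe_sub ht, hl, Real.coe_toNNReal _ hc.le]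
      have hlb : (l' b : ℝ) = B / m := by
        rw [h2' b hab.le]
        field_simp
        ring
      refine ⟨l', hlb, fun t ht => ?_⟩
      rcases lt_or_ge t a with hta | hta
      · rw [h1 t hta.le]
        exact hlt t hta
      · have hta' : (a : ℝ) ≤ t := by exact_mod_cast hta
        have htb' : (t : ℝ) < b := by exact_mod_cast ht
        set θ : ℝ := ((t : ℝ) - a) / (b - a) with hθ
        have θ0 : 0 ≤ θ := div_nonneg (by linarith) hab'.le
        have θ1 : θ ≤ 1 := (div_le_one hab').2 (by linarith)
        have hθt : (t : ℝ) = a + θ * (b - a) := by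
          rw [hθ]; field_simp; ring
        have hlθ : (m : ℝ) * l' t = A + θ * (B - A) := by
          rw [h2' t hta, hθ]; field_simp
        have g1 : (m : ℝ) * t ≤ m * l' t := by rw [hlθ, hθt]; nlinarith
        have g2 : (m : ℝ) * l' t ≤ m * t + 1 := by rw [hlθ, hθt]; nlinarith
        refine ⟨le_of_mul_le_mul_left g1 hmR, ?_, ?_⟩
        · refine le_of_mul_le_mul_left (g2.trans_eq ?_) hmR
          field_simp
        · set k := ⌊(m : ℝ≥0) * l' t⌋₊ with hk
          have k1 : A ≤ k := by
            refine Nat.le_floor ?_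
            have : (A : ℝ) ≤ m * l' t := by rw [hlθ]; nlinarith
            exact_mod_cast this
          have k2 : k < B := by
            refine (Nat.floor_lt zero_le).2 ?_
            have h3 : (l' t : ℝ) < B / m := by
              rw [← hlb]
              exact_mod_cast l'.strictMono ht
            rw [lt_div_iff₀ hmR, mul_comm] at h3
            exact_mod_cast h3
          have hm' : (0 : ℝ≥0) < m := by exact_mod_cast hmpos
          rw [hconst t hta ht]
          refine hconst _ ?_ ?_
          · rw [le_div_iff₀ hm', mul_comm]
            exact (Nat.ceil_le.1 k1)
          · rw [div_lt_iff₀ hm', mul_comm]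
            exact Nat.lt_ceil.1 k2
  obtain ⟨m₁, hm₁⟩ := exists_nat_gt (1 / ε)
  obtain ⟨m₂, hm₂⟩ := exists_nat_ge (M + 1)
  filter_upwards [key, eventually_ge_atTop m₁, eventually_ge_atTop (m₂ + 1),
    eventually_gt_atTop 0] with m hm h1 h2 h3
  obtain ⟨l, -, hl⟩ := hm
  have hmR : (0 : ℝ) < m := by exact_mod_cast h3
  have hmε : 1 / (m : ℝ) < ε := by
    rw [div_lt_comm₀ hmR hε]
    exact hm₁.trans_le (by exact_mod_cast h1)
  refine ⟨l, fun t ht => ?_⟩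
  have htM : t < M + 1 := ht.trans_lt (by simp)
  obtain ⟨a1, a2, a3⟩ := hl t htM
  refine ⟨by rw [abs_lt]; constructor <;> linarith, ?_⟩
  have hle : ⌊(m : ℝ≥0) * l t⌋₊ ≤ m * m := by
    have : (l t : ℝ) ≤ m := by
      have b1 : (t : ℝ) ≤ M := by exact_mod_cast ht
      have b2 : (M : ℝ) + 1 ≤ m₂ := by exact_mod_cast hm₂
      have b3 : (m₂ : ℝ) + 1 ≤ m := by exact_mod_cast h2
      have b4 : 1 / (m : ℝ) ≤ 1 := by
        rw [div_le_one hmR]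
        exact_mod_cast h3
      linarith
    have h5 : (m : ℝ≥0) * l t ≤ ((m * m : ℕ) : ℝ≥0) := by
      push_cast
      exact mul_le_mul_right (by exact_mod_cast this) _
    exact Nat.floor_le_of_le h5
  change ω ((min ⌊(m : ℝ≥0) * l t⌋₊ (m * m) : ℕ) / m) = ω t
  rw [min_eq_left hle]
  exact a3

theorem tendsto_stepPath (ω : PathSpace E) :
    Tendsto (fun m : ℕ => stepPath m fun k => ω (k / m)) atTop (𝓝 ω) := by
  rw [(nhds_basis_uniformity' hasBasis_uniformity).tendsto_right_iff]
  rintro ⟨M, ε⟩ hε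
  exact eventually_close_stepPath ω M hε

theorem measurableSet_eval (t : ℝ≥0) (s : Set E) :
    MeasurableSet {ω : PathSpace E | ω t ∈ s} := by
  refine (le_iSup (fun t : ℝ≥0 => (borel E).comap (fun ω : PathSpace E => ω t)) t) _ ?_
  exact ⟨s, by rw [borel_eq_top_of_discrete]; trivial, rfl⟩

/-- For countable discrete `E`, Skorohod-open sets belong to the σ-algebra of the coordinates. -/
instance [Countable E] : OpensMeasurableSpace (PathSpace E) := by
  let _ : PseudoMetricSpace (PathSpace E) := UniformSpace.pseudoMetricSpace _
  have hmeas : ∀ (m : ℕ) (U : Set (PathSpace E)),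
      MeasurableSet {ω : PathSpace E | stepPath m (fun k => ω (k / m)) ∈ U} := by
    intro m U
    let r : (Fin (m * m + 1) → E) → PathSpace E :=
      fun x => stepPath m fun k => x ⟨min k (m * m), by omega⟩
    have hr : ∀ ω : PathSpace E, stepPath m (fun k => ω (k / m)) =
        r fun i => ω ((i : ℕ) / m) := by
      intro ω
      apply Subtype.ext
      funext t
      simp [r, stepPath]
    have : {ω : PathSpace E | stepPath m (fun k => ω (k / m)) ∈ U} =
        ⋃ x ∈ r ⁻¹' U, ⋂ i : Fin (m * m + 1), {ω : PathSpace E | ω ((i : ℕ) / m) ∈ ({x i} : Set E)} := by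
      ext ω
      simp only [hr, mem_ofPred_eq, mem_iUnion, mem_iInter, mem_preimage, mem_singleton_iff,
        exists_prop]
      constructor
      · exact fun h => ⟨_, h, fun i => rfl⟩
      · rintro ⟨x, hx, h⟩
        rwa [show (fun i : Fin (m * m + 1) => ω ((i : ℕ) / m)) = x from funext h]
    rw [this]
    exact MeasurableSet.biUnion (to_countable _) fun x _ =>
      MeasurableSet.iInter fun i => measurableSet_eval _ _
  refine ⟨borel_eq_generateFrom_isClosed.le.trans (MeasurableSpace.generateFrom_le ?_)⟩
  intro C hC
  have hf : Measurable fun ω : PathSpace E => Metric.infEDist ω C := by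
    refine measurable_of_tendsto_metrizable
      (f := fun m ω => Metric.infEDist (stepPath m fun k => ω (k / m)) C) (fun m => ?_) ?_
    · intro s _
      exact hmeas m ((fun ω => Metric.infEDist ω C) ⁻¹' s)
    · rw [tendsto_pi_nhds]
      intro ω
      exact (Metric.continuous_infEDist.tendsto ω).comp (tendsto_stepPath ω)
  have : C = (fun ω : PathSpace E => Metric.infEDist ω C) ⁻¹' {0} := by
    ext ω
    exact Metric.mem_iff_infEDist_zero_of_closed hC
  rw [this]
  exact hf (measurableSet_singleton 0)

end borel

end PathSpace

open PathSpace

/-! ### Markov processes -/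

/-- `(P x)_{x ∈ E}` is a (time-homogeneous) Markov process on `D(ℝ₊, E)`: `P x` is the law of the
process started at `x`, and for `A ∈ σ(ω r : r ≤ s)` and every event `B`,
`P x (A ∩ θ_s⁻¹ B) = ∫_A P (ω s) B dP x`. -/
structure IsMarkovProcess {E : Type*} [TopologicalSpace E]
    (P : E → ProbabilityMeasure (PathSpace E)) : Prop where
  start : ∀ x, ∀ᵐ ω ∂(P x : Measure (PathSpace E)), ω 0 = x
  markov : ∀ (x : E) (s : ℝ≥0) (A B : Set (PathSpace E)),
    MeasurableSet[past E s] A → MeasurableSet B →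
    (P x : Measure (PathSpace E)) (A ∩ shift s ⁻¹' B) =
      ∫⁻ ω in A, (P (ω s) : Measure (PathSpace E)) B ∂(P x : Measure (PathSpace E))

/-- `(P η)_{η ∈ E}` has the generator `(L f) η = ∑ ξ, (f ξ - f η) R η ξ`: for every `f : E → ℝ`,
`L f` is the derivative at `t = 0` (from the right) of `t ↦ 𝔼_η [f (η_t)]`. -/
def HasJumpRates {E : Type*} [TopologicalSpace E] [Fintype E]
    (R : E → E → ℝ≥0) (P : E → ProbabilityMeasure (PathSpace E)) : Prop :=
  ∀ (f : E → ℝ) (η : E),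
    HasDerivWithinAt (fun t : ℝ => ∫ ω, f (ω t.toNNReal) ∂(P η : Measure (PathSpace E)))
      (∑ ξ, (f ξ - f η) * (R η ξ : ℝ)) (Ici 0) 0

/-- Every state can be reached from every other one through jumps of positive rate. -/
def IsIrreducibleRates {E : Type*} (R : E → E → ℝ≥0) : Prop :=
  ∀ η ξ, Relation.ReflTransGen (fun a b => 0 < R a b) η ξ

open Classical in
/-- The projection `Ψ` that maps the points of `𝓔 x` to `x`. Its value outside of `⋃ x, 𝓔 x` is
irrelevant. -/
noncomputable def metaProj {κ : ℕ} [NeZero κ] {E : Type*} (𝓔 : Fin κ → Set E) (η : E) : Fin κ :=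
  if h : ∃ x, η ∈ 𝓔 x then h.choose else 0

/-! ### Trace and last-visit processes -/

section paths

variable {E : Type*} [TopologicalSpace E]

/-- The time `𝓣^F_t(ω) = ∫₀ᵗ 𝟏{ω s ∈ F} ds` spent in `F` during `[0, t]`. -/
noncomputable def occupationTime (F : Set E) (t : ℝ≥0) (ω : PathSpace E) : ℝ≥0∞ :=
  ∫⁻ s in Icc (0 : ℝ) t, F.indicator 1 (ω s.toNNReal)

/-- The generalized inverse `𝓢^F_t(ω) = sup {s ≥ 0 : 𝓣^F_s(ω) ≤ t}`. -/
noncomputable def inverseOccupationTime (F : Set E) (t : ℝ≥0) (ω : PathSpace E) : ℝ≥0 :=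
  sSup {s : ℝ≥0 | occupationTime F s ω ≤ t}

/-- The trace `t ↦ ω (𝓢^F_t)` of the path `ω` on `F`. -/
noncomputable def tracePath (F : Set E) (ω : PathSpace E) (t : ℝ≥0) : E :=
  ω (inverseOccupationTime F t ω)

/-- The last time `σ(t) = sup {s ≤ t : ω s ∈ F}` before `t` at which `ω` is in `F`. -/
noncomputable def lastTime (F : Set E) (ω : PathSpace E) (t : ℝ≥0) : ℝ≥0 :=
  sSup {s : ℝ≥0 | s ≤ t ∧ ω s ∈ F}

open Classical in
/-- The last point of `F` visited by `ω` up to time `t`: it is `ω (σ(t))` if the supremum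
defining `σ(t)` is attained, and the left limit `ω (σ(t)-)` otherwise. -/
noncomputable def lastVisit (F : Set E) (ω : PathSpace E) (t : ℝ≥0) : E :=
  if ω (lastTime F ω t) ∈ F then ω (lastTime F ω t) else Function.leftLim ω (lastTime F ω t)

variable {κ : ℕ} [NeZero κ]

/-- The path of `X_t = Ψ(η^𝓔_t)`, where `η^𝓔` is the trace of `η` on `⋃ x, 𝓔 x`. -/
noncomputable def traceProcess (𝓔 : Fin κ → Set E) (ω : PathSpace E) : PathSpace (Fin κ) :=
  ofFun fun t => metaProj 𝓔 (tracePath (⋃ x, 𝓔 x) ω t)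

/-- The path of `X̂_t`, the image under `Ψ` of the last point of `⋃ x, 𝓔 x` visited up to `t`. -/
noncomputable def lastVisitProcess (𝓔 : Fin κ → Set E) (ω : PathSpace E) : PathSpace (Fin κ) :=
  ofFun fun t => metaProj 𝓔 (lastVisit (⋃ x, 𝓔 x) ω t)

end paths

/-! ### Meta-stability -/

/-- The sequence of Markov processes `(P N)` is meta-stable with meta-states `𝓔 N x` and limit the
Markov process `(Q x)`. -/
structure IsMetastable {κ : ℕ} [NeZero κ] {E : ℕ → Type*} [∀ N, TopologicalSpace (E N)]
    (P : ∀ N, E N → ProbabilityMeasure (PathSpace (E N))) (𝓔 : ∀ N, Fin κ → Set (E N))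
    (Q : Fin κ → ProbabilityMeasure (PathSpace (Fin κ))) : Prop where
  isMarkovProcess_limit : IsMarkovProcess Q
  tendsto_trace : ∀ (x : Fin κ) (η : ∀ N, E N), (∀ N, η N ∈ 𝓔 N x) →
    TendstoInDistribution (fun N => traceProcess (𝓔 N)) atTop id
      (fun N => (P N (η N) : Measure (PathSpace (E N)))) (Q x : Measure (PathSpace (Fin κ)))
  tendsto_occupationTime : ∀ t : ℝ≥0, 0 < t →
    Tendsto (fun N => ⨆ η ∈ ⋃ x, 𝓔 N x,
      ∫⁻ ω, occupationTime (⋃ x, 𝓔 N x)ᶜ t ω ∂(P N η : Measure (PathSpace (E N)))) atTop (𝓝 0)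

/-! The trace deletes the excursions outside `⋃ x, 𝓔 x`, and the last-visit path freezes during
them. Both run through the same values in the same order, so they differ only by a change of clock,
and the clocks differ by the time spent outside. The inverse occupation clock jumps at each
excursion, so it is not itself an admissible time change. But a path in a discrete space holds a
value for a positive time before it leaves, and the jump can be spread over that holding interval.
`exists_timeChange` obtains in this way a bijection whose displacement up to time `T` is at most the
time spent outside up to `T`. The two paths are therefore Skorohod close when that time is small
(`traceProcess_lastVisitProcess_mem_closePairs`), which is likely by condition (B) and Markov's
inequality. Convergence together (`of_tendsto_measure_notMem_entourage`) transfers the limit.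

Two side conditions remain. The trace is shown to be càdlàg when the occupation clock is unbounded;
this holds almost surely because the chain is irreducible on a finite space (`ae_exists_lt_timeIn`).
The last-visit process must be a.e. measurable for the coordinate σ-algebra; `lastVisit_eq_iff`
describes its values through countably many times. -/

section paths

/-! ### Elementary properties of last visits and occupation times -/

variable {E : Type*} [TopologicalSpace E]

theorem lastTime_eq_self {F : Set E} {ω : PathSpace E} {t : ℝ≥0} (h : ω t ∈ F) :
    lastTime F ω t = t :=
  IsGreatest.csSup_eq ⟨⟨le_rfl, h⟩, fun _ hs => hs.1⟩

theorem lastVisit_eq_self {F : Set E} {ω : PathSpace E} {t : ℝ≥0} (h : ω t ∈ F) :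
    lastVisit F ω t = ω t := by
  rw [lastVisit, lastTime_eq_self h, if_pos h]

theorem lastVisit_congr {F : Set E} {ω : PathSpace E} {a t : ℝ≥0} (hat : a ≤ t)
    (h : ∀ s, a ≤ s → s ≤ t → ω s ∉ F) : lastVisit F ω t = lastVisit F ω a := by
  have : lastTime F ω t = lastTime F ω a := by
    unfold lastTime
    congr 1
    ext s
    constructor
    · rintro ⟨h1, h2⟩
      exact ⟨le_of_not_ge fun h3 => h s h3 h1 h2, h2⟩
    · rintro ⟨h1, h2⟩
      exact ⟨h1.trans hat, h2⟩
  rw [lastVisit, lastVisit, this]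

/-- Capping the time at `t` makes the integrand depend on the path up to `t` only, which later
yields measurability with respect to `past E t`. -/
theorem occupationTime_eq_min (F : Set E) (t : ℝ≥0) (ω : PathSpace E) :
    occupationTime F t ω =
      ∫⁻ s in Icc (0 : ℝ) t, F.indicator 1 (ω (min t s.toNNReal)) := by
  refine setLIntegral_congr_fun measurableSet_Icc fun s hs => ?_
  have : s.toNNReal ≤ t := Real.toNNReal_le_iff_le_coe.2 hs.2
  simp only [min_eq_right this]

theorem occupationTime_add (F : Set E) (s t : ℝ≥0) (ω : PathSpace E) :
    occupationTime F (s + t) ω = occupationTime F s ω + occupationTime F t (shift s ω) := by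
  have h1 : Icc (0 : ℝ) ((s + t : ℝ≥0) : ℝ) = Icc (0 : ℝ) s ∪ Ioc (s : ℝ) (s + t) := by
    rw [Icc_union_Ioc_eq_Icc s.coe_nonneg (le_add_of_nonneg_right t.coe_nonneg), NNReal.coe_add]
  have h2 : ∫⁻ u in Ioc (s : ℝ) (s + t), F.indicator (1 : E → ℝ≥0∞) (ω u.toNNReal) =
      occupationTime F t (shift s ω) := by
    rw [occupationTime, ← setLIntegral_congr Ioc_ae_eq_Icc]
    have hmp : MeasurePreserving (fun u : ℝ => (s : ℝ) + u) volume volume :=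
      measurePreserving_add_left volume (s : ℝ)
    rw [← hmp.setLIntegral_comp_preimage_emb (measurableEmbedding_addLeft _)]
    rw [preimage_const_add_Ioc]
    simp only [sub_self, add_sub_cancel_left]
    refine setLIntegral_congr_fun measurableSet_Ioc fun u hu => ?_
    have : ((s : ℝ) + u).toNNReal = s + u.toNNReal := by
      rw [Real.toNNReal_add s.coe_nonneg hu.1.le, Real.toNNReal_coe]
    exact congrArg (fun r => F.indicator (1 : E → ℝ≥0∞) (ω r)) this
  rw [occupationTime, h1, lintegral_union measurableSet_Ioc, h2]
  · rfl
  · exact (disjoint_left.2 fun u hu hu' => absurd hu.2 (not_le.2 hu'.1))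

theorem occupationTime_mono (F : Set E) (ω : PathSpace E) :
    Monotone fun t => occupationTime F t ω := by
  intro s t hst
  obtain ⟨u, rfl⟩ := exists_add_of_le hst
  simp only [occupationTime_add]
  exact le_add_right le_rfl

theorem occupationTime_eq_zero {F : Set E} {t : ℝ≥0} {ω : PathSpace E}
    (h : ∀ s < t, ω s ∉ F) : occupationTime F t ω = 0 := by
  rw [occupationTime, ← setLIntegral_congr Ico_ae_eq_Icc]
  refine (setLIntegral_congr_fun measurableSet_Ico fun s hs => ?_).trans (lintegral_zero)
  exact indicator_of_notMem (h _ ((Real.toNNReal_lt_iff_lt_coe hs.1).2 hs.2)) _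

theorem occupationTime_of_notMem {F : Set E} {a b : ℝ≥0} {ω : PathSpace E} (hab : a ≤ b)
    (h : ∀ s, a ≤ s → s < b → ω s ∉ F) : occupationTime F b ω = occupationTime F a ω := by
  obtain ⟨u, rfl⟩ := exists_add_of_le hab
  rw [occupationTime_add, occupationTime_eq_zero (t := u), add_zero]
  exact fun s hs => h _ le_self_add (by gcongr)

theorem ofFun_apply {f : ℝ≥0 → E} (hf : IsCadlag f) (t : ℝ≥0) : ofFun f t = f t := by
  have : ofFun f = ⟨f, hf⟩ := dif_pos hf
  rw [this]

end paths

/-! ### Local constancy of càdlàg paths in a discrete space -/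

section discretePaths

variable {E : Type*} [TopologicalSpace E] [DiscreteTopology E]

theorem PathSpace.exists_eq_right (ω : PathSpace E) (t : ℝ≥0) :
    ∃ c, t < c ∧ ∀ s, t ≤ s → s < c → ω s = ω t := by
  have hev : ∀ᶠ s in 𝓝[≥] t, ω s = ω t := by
    exact ω.2.1 t ((isOpen_discrete {ω t}).mem_nhds rfl)
  obtain ⟨c, hc, hcs⟩ := (mem_nhdsGE_iff_exists_Ico_subset' (lt_add_one t)).1 hev
  exact ⟨c, hc, fun s h1 h2 => hcs ⟨h1, h2⟩⟩

theorem PathSpace.exists_eq_left (ω : PathSpace E) {t : ℝ≥0} (ht : 0 < t) :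
    ∃ c v, c < t ∧ ∀ s, c ≤ s → s < t → ω s = v := by
  obtain ⟨v, hv⟩ := ω.2.2 t
  have hev : ∀ᶠ s in 𝓝[<] t, ω s = v := by
    exact hv ((isOpen_discrete {v}).mem_nhds rfl)
  obtain ⟨c, hc, hcs⟩ := (mem_nhdsLT_iff_exists_Ioo_subset' ht).1 hev
  obtain ⟨d, hcd, hdt⟩ := exists_between (show c < t from hc)
  exact ⟨d, v, hdt, fun s h1 h2 => hcs ⟨hcd.trans_le h1, h2⟩⟩

theorem isCadlag_of_locally_eq {f : ℝ≥0 → E}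
    (hr : ∀ t, ∃ c, t < c ∧ ∀ s, t ≤ s → s < c → f s = f t)
    (hl : ∀ t, 0 < t → ∃ c v, c < t ∧ ∀ s, c ≤ s → s < t → f s = v) : IsCadlag f := by
  refine ⟨fun t => ?_, fun t => ?_⟩
  · obtain ⟨c, hc, h⟩ := hr t
    refine tendsto_nhds_of_eventually_eq ?_
    filter_upwards [Ico_mem_nhdsGE hc] with s hs using h s hs.1 hs.2
  · rcases eq_zero_or_pos t with rfl | ht
    · exact ⟨f 0, by simp⟩
    · obtain ⟨c, v, hc, h⟩ := hl t ht
      refine ⟨v, tendsto_nhds_of_eventually_eq ?_⟩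
      filter_upwards [Ico_mem_nhdsLT hc] with s hs using h s hs.1 hs.2

/-! ### The last visited point -/

/-- The visits accumulate at `b` from the left and stop there, so the last time is `b` and is not
attained; the left limit at `b` is the holding value `v`. -/
theorem lastVisit_eq_of_excursion {F : Set E} {ω : PathSpace E} {a b t : ℝ≥0} {v : E} (hv : v ∈ F)
    (hab : a < b) (hbt : b ≤ t) (hc : ∀ s, a ≤ s → s < b → ω s = v)
    (h : ∀ s, b ≤ s → s ≤ t → ω s ∉ F) : lastVisit F ω t = v := by
  have hb : ω b ∉ F := h b le_rfl hbt
  have hlt : lastTime F ω t = b := by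
    refine csSup_eq_of_forall_le_of_forall_lt_exists_gt
      ⟨a, hab.le.trans hbt, by rwa [hc a le_rfl hab]⟩ ?_ ?_
    · rintro s ⟨h1, h2⟩
      exact le_of_not_ge fun h3 => h s h3 h1 h2
    · intro w hw
      obtain ⟨s, hs, hsb⟩ := exists_between (max_lt hw hab)
      refine ⟨s, ⟨hsb.le.trans hbt, ?_⟩, (le_max_left _ _).trans_lt hs⟩
      rwa [hc s ((le_max_right _ _).trans hs.le) hsb]
  rw [lastVisit, hlt, if_neg hb]
  have : (𝓝[<] b).NeBot := nhdsLT_neBot_of_exists_lt ⟨a, hab⟩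
  refine leftLim_eq_of_tendsto (tendsto_nhds_of_eventually_eq ?_)
  filter_upwards [Ico_mem_nhdsLT hab] with s hs using hc s hs.1 hs.2

/-- On an interval where `ω` is constant, the last visit is either that constant value or frozen,
hence constant too. -/
theorem isCadlag_lastVisit (F : Set E) (ω : PathSpace E) : IsCadlag (lastVisit F ω) := by
  refine isCadlag_of_locally_eq (fun t => ?_) fun t ht => ?_
  · obtain ⟨c, hc, h⟩ := ω.exists_eq_right t
    refine ⟨c, hc, fun s h1 h2 => ?_⟩
    by_cases hF : ω t ∈ F
    · rw [lastVisit_eq_self hF, lastVisit_eq_self (by rwa [h s h1 h2]), h s h1 h2]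
    · exact lastVisit_congr h1 fun r h3 h4 => by rwa [h r h3 (h4.trans_lt h2)]
  · obtain ⟨c, v, hc, h⟩ := ω.exists_eq_left ht
    refine ⟨c, lastVisit F ω c, hc, fun s h1 h2 => ?_⟩
    by_cases hF : v ∈ F
    · rw [lastVisit_eq_self (by rwa [h s h1 h2]), lastVisit_eq_self (by rwa [h c le_rfl hc]),
        h s h1 h2, h c le_rfl hc]
    · exact lastVisit_congr h1 fun r h3 h4 => by rwa [h r h3 (h4.trans_lt h2)]

theorem IsCadlag.comp_discrete {E' : Type*} [TopologicalSpace E'] {f : ℝ≥0 → E}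
    (hf : IsCadlag f) (g : E → E') : IsCadlag fun t => g (f t) := by
  refine ⟨fun t => continuous_of_discreteTopology.continuousAt.comp_continuousWithinAt (hf.1 t),
    fun t => ?_⟩
  obtain ⟨l, hl⟩ := hf.2 t
  exact ⟨g l, (continuous_of_discreteTopology.tendsto l).comp hl⟩

/-! ### Occupation times -/

/-- The grid points approach `s` from above, as right-continuity of paths requires. -/
theorem tendsto_floor_add_one_div (s : ℝ≥0) :
    Tendsto (fun m : ℕ => ((⌊(m : ℝ≥0) * s⌋₊ : ℝ≥0) + 1) / m) atTop (𝓝 s) := by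
  have h1 : Tendsto (fun m : ℕ => s + 1 / (m : ℝ≥0)) atTop (𝓝 (s + 0)) :=
    tendsto_const_nhds.add tendsto_one_div_atTop_nhds_zero_nat
  rw [add_zero] at h1
  refine tendsto_of_tendsto_of_tendsto_of_le_of_le' tendsto_const_nhds h1 ?_ ?_
  · filter_upwards [eventually_gt_atTop 0] with m hm
    rw [le_div_iff₀ (by exact_mod_cast hm), mul_comm]
    exact (Nat.lt_floor_add_one _).le
  · filter_upwards [eventually_gt_atTop 0] with m hm
    have hm' : (0 : ℝ≥0) < m := by exact_mod_cast hm
    rw [div_le_iff₀ hm', add_mul, one_div, inv_mul_cancel₀ hm'.ne', mul_comm s]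
    gcongr
    exact Nat.floor_le zero_le

/-- The state at time `min t s` is jointly measurable in the path and in `s`. -/
theorem measurable_indicator_eval {Ω : Type*} [MeasurableSpace Ω] {Y : Ω → PathSpace E}
    {t : ℝ≥0} (F : Set E) (hY : ∀ r ≤ t, MeasurableSet {a | Y a r ∈ F}) :
    Measurable fun p : Ω × ℝ => F.indicator (1 : E → ℝ≥0∞) (Y p.1 (min t p.2.toNNReal)) := by
  refine measurable_of_tendsto_metrizable (f := fun (m : ℕ) (p : Ω × ℝ) =>
    F.indicator (1 : E → ℝ≥0∞)
      (Y p.1 (min t (((⌊(m : ℝ≥0) * p.2.toNNReal⌋₊ : ℝ≥0) + 1) / m)))) (fun m => ?_) ?_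
  -- The approximation sees `s` only through an integer, so measurability can be checked one grid
  -- time at a time.
  · have h1 : Measurable fun q : Ω × ℕ =>
        F.indicator (1 : E → ℝ≥0∞) (Y q.1 (min t (((q.2 : ℝ≥0) + 1) / m))) := by
      refine measurable_from_prod_countable_left fun k => ?_
      have : (fun a : Ω => F.indicator (1 : E → ℝ≥0∞) (Y a (min t (((k : ℝ≥0) + 1) / m)))) =
          {a | Y a (min t (((k : ℝ≥0) + 1) / m)) ∈ F}.indicator 1 := by
        funext a
        simp [indicator]
      rw [this]
      exact measurable_one.indicator (hY _ (min_le_left _ _))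
    have h2 : Measurable fun p : Ω × ℝ => (p.1, ⌊(m : ℝ≥0) * p.2.toNNReal⌋₊) := by
      refine measurable_fst.prodMk (Nat.measurable_floor.comp ?_)
      fun_prop
    exact h1.comp h2
  · rw [tendsto_pi_nhds]
    rintro ⟨a, s⟩
    refine tendsto_nhds_of_eventually_eq ?_
    obtain ⟨c, hc, h⟩ := (Y a).exists_eq_right (min t s.toNNReal)
    have hlim : Tendsto (fun m : ℕ => min t (((⌊(m : ℝ≥0) * s.toNNReal⌋₊ : ℝ≥0) + 1) / m)) atTop
        (𝓝 (min t s.toNNReal)) := tendsto_const_nhds.min (tendsto_floor_add_one_div _)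
    filter_upwards [hlim (Iio_mem_nhds hc), eventually_gt_atTop 0] with m hm hm0
    rw [h _ (min_le_min le_rfl ?_) hm]
    rw [le_div_iff₀ (by exact_mod_cast hm0), mul_comm]
    exact (Nat.lt_floor_add_one _).le

theorem measurable_occupationTime_comp {Ω : Type*} [MeasurableSpace Ω] {Y : Ω → PathSpace E}
    {t : ℝ≥0} (F : Set E) (hY : ∀ r ≤ t, MeasurableSet {a | Y a r ∈ F}) :
    Measurable fun a => occupationTime F t (Y a) := by
  simp only [occupationTime_eq_min]
  exact (measurable_indicator_eval F hY).lintegral_prod_right'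

theorem measurable_occupationTime (F : Set E) (t : ℝ≥0) :
    Measurable fun ω : PathSpace E => occupationTime F t ω :=
  measurable_occupationTime_comp (Y := id) F fun r _ => measurableSet_eval r F

theorem measurable_past_occupationTime (F : Set E) (t : ℝ≥0) :
    Measurable[past E t] fun ω : PathSpace E => occupationTime F t ω := by
  refine @measurable_occupationTime_comp E _ _ (PathSpace E) (past E t) id t F fun r hr => ?_
  refine (le_iSup₂ (f := fun (r : ℝ≥0) (_ : r ≤ t) =>
    (borel E).comap (fun ω : PathSpace E => ω r)) r hr) _ ?_
  exact ⟨F, by rw [borel_eq_top_of_discrete]; trivial, rfl⟩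

theorem measurable_indicator_path (F : Set E) (t : ℝ≥0) (ω : PathSpace E) :
    Measurable fun s : ℝ => F.indicator (1 : E → ℝ≥0∞) (ω (min t s.toNNReal)) :=
  (measurable_indicator_eval (Y := id) (t := t) F fun r _ => measurableSet_eval r F).comp
    (measurable_const (a := ω) |>.prodMk measurable_id)

theorem occupationTime_add_compl (F : Set E) (t : ℝ≥0) (ω : PathSpace E) :
    occupationTime F t ω + occupationTime Fᶜ t ω = t := by
  rw [occupationTime_eq_min, occupationTime_eq_min,
    ← lintegral_add_left (measurable_indicator_path F t ω)]
  have : ∀ s : ℝ, F.indicator (1 : E → ℝ≥0∞) (ω (min t s.toNNReal)) +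
      Fᶜ.indicator 1 (ω (min t s.toNNReal)) = 1 := by
    intro s
    by_cases h : ω (min t s.toNNReal) ∈ F <;> simp [h]
  simp [this]

theorem occupationTime_le (F : Set E) (t : ℝ≥0) (ω : PathSpace E) :
    occupationTime F t ω ≤ t :=
  (le_add_right le_rfl).trans_eq (occupationTime_add_compl F t ω)

theorem occupationTime_eq_self {F : Set E} {t : ℝ≥0} {ω : PathSpace E}
    (h : ∀ s < t, ω s ∈ F) : occupationTime F t ω = t := by
  rw [← occupationTime_add_compl F t ω, occupationTime_eq_zero (F := Fᶜ), add_zero]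
  exact fun s hs => not_not.2 (h s hs)

theorem occupationTime_of_mem {F : Set E} {a b : ℝ≥0} {ω : PathSpace E} (hab : a ≤ b)
    (h : ∀ s, a ≤ s → s < b → ω s ∈ F) :
    occupationTime F b ω = occupationTime F a ω + (b - a : ℝ≥0) := by
  obtain ⟨u, rfl⟩ := exists_add_of_le hab
  rw [occupationTime_add, occupationTime_eq_self (t := u), add_tsub_cancel_left]
  exact fun s hs => h _ le_self_add (by gcongr)

/-- The path stays in `F` for a while after `u`, so the occupation clock exceeds `s` immediately
after `u`. -/
theorem inverseOccupationTime_eq {F : Set E} {u s : ℝ≥0} {ω : PathSpace E} (h : ω u ∈ F)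
    (hs : occupationTime F u ω = s) : inverseOccupationTime F s ω = u := by
  refine IsGreatest.csSup_eq ⟨hs.le, fun r hr => ?_⟩
  by_contra! hur
  obtain ⟨c, hc, hconst⟩ := ω.exists_eq_right u
  have h1 : occupationTime F (min c r) ω ≤ s := (occupationTime_mono F ω (min_le_right _ _)).trans hr
  have hlt : u < min c r := lt_min hc hur
  rw [occupationTime_of_mem hlt.le fun v h2 h3 => by
    rwa [hconst v h2 (h3.trans_le (min_le_left _ _))], hs] at h1
  have h2 : s + (min c r - u) ≤ s := by exact_mod_cast h1
  exact absurd h2 (not_le.2 (lt_add_of_pos_right _ (tsub_pos_of_lt hlt)))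

end discretePaths

/-! ### The time change between the trace and the last-visit process -/

section timeChange

variable {E : Type*} [TopologicalSpace E] [DiscreteTopology E]

/-- The occupation time as a nonnegative real number. -/
noncomputable def timeIn (F : Set E) (ω : PathSpace E) (t : ℝ≥0) : ℝ≥0 :=
  (occupationTime F t ω).toNNReal

theorem coe_timeIn (F : Set E) (ω : PathSpace E) (t : ℝ≥0) :
    (timeIn F ω t : ℝ≥0∞) = occupationTime F t ω :=
  ENNReal.coe_toNNReal (ne_top_of_le_ne_top ENNReal.coe_ne_top (occupationTime_le F t ω))

theorem timeIn_zero (F : Set E) (ω : PathSpace E) : timeIn F ω 0 = 0 := by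
  have := occupationTime_le F 0 ω
  rw [← coe_timeIn] at this
  exact le_antisymm (by exact_mod_cast this) zero_le

omit [DiscreteTopology E] in
theorem timeIn_of_notMem {F : Set E} {a b : ℝ≥0} {ω : PathSpace E} (hab : a ≤ b)
    (h : ∀ s, a ≤ s → s < b → ω s ∉ F) : timeIn F ω b = timeIn F ω a := by
  rw [timeIn, occupationTime_of_notMem hab h, timeIn]

theorem timeIn_of_mem {F : Set E} {a b : ℝ≥0} {ω : PathSpace E} (hab : a ≤ b)
    (h : ∀ s, a ≤ s → s < b → ω s ∈ F) : timeIn F ω b = timeIn F ω a + (b - a) := by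
  have := occupationTime_of_mem hab h
  rw [← coe_timeIn, ← coe_timeIn] at this
  exact_mod_cast this

theorem timeIn_add_compl (F : Set E) (ω : PathSpace E) (t : ℝ≥0) :
    timeIn F ω t + timeIn Fᶜ ω t = t := by
  have := occupationTime_add_compl F t ω
  rw [← coe_timeIn, ← coe_timeIn] at this
  exact_mod_cast this

/-- The clock runs at unit speed on `[a, b)`, so it reads `s` at time `a + (s - timeIn F ω a)`. -/
theorem tracePath_of_mem {F : Set E} {a b s : ℝ≥0} {v : E} {ω : PathSpace E} (hv : v ∈ F)
    (h : ∀ r, a ≤ r → r < b → ω r = v) (hs : timeIn F ω a ≤ s) (hsb : a + (s - timeIn F ω a) < b) :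
    tracePath F ω s = v := by
  have hu := h _ le_self_add hsb
  rw [tracePath, inverseOccupationTime_eq (u := a + (s - timeIn F ω a)), hu]
  · rwa [hu]
  · rw [← coe_timeIn, timeIn_of_mem le_self_add fun r h1 h2 => by rwa [h r h1 (h2.trans hsb)],
      add_tsub_cancel_left, add_tsub_cancel_of_le hs]

/-- Up to time `T` the last-visit process is the trace process after a time change that moves the
points by at most the time spent outside of `F`. -/
theorem exists_timeChange {F : Set E} {ω : PathSpace E} (h0 : ω 0 ∈ F) (T : ℝ≥0) :
    ∃ l : ℝ≥0 ≃o ℝ≥0, l (timeIn F ω T) = T ∧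
      (∀ s ≤ timeIn F ω T, (s : ℝ) ≤ l s ∧ (l s : ℝ) - s ≤ T - timeIn F ω T) ∧
      ∀ s < timeIn F ω T, lastVisit F ω (l s) = tracePath F ω s := by
  -- The induction also remembers the latest holding interval `[a, b)` in `F`, and that `l` passes
  -- through `(timeIn F ω a, a)`: this is where `l` is redefined when an excursion gets longer.
  suffices h : ∃ l : ℝ≥0 ≃o ℝ≥0, l (timeIn F ω T) = T ∧
      (∀ s ≤ timeIn F ω T, (s : ℝ) ≤ l s ∧ (l s : ℝ) - s ≤ T - timeIn F ω T) ∧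
      (∀ s < timeIn F ω T, lastVisit F ω (l s) = tracePath F ω s) ∧
      (0 < T → ∃ a b v, a < b ∧ b ≤ T ∧ v ∈ F ∧ l (timeIn F ω a) = a ∧
        (∀ s, a ≤ s → s < b → ω s = v) ∧ ∀ s, b ≤ s → s < T → ω s ∉ F) by
    obtain ⟨l, h1, h2, h3, -⟩ := h
    exact ⟨l, h1, h2, h3⟩
  refine cadlag_induction ω (p := fun T => ∃ l : ℝ≥0 ≃o ℝ≥0, l (timeIn F ω T) = T ∧
      (∀ s ≤ timeIn F ω T, (s : ℝ) ≤ l s ∧ (l s : ℝ) - s ≤ T - timeIn F ω T) ∧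
      (∀ s < timeIn F ω T, lastVisit F ω (l s) = tracePath F ω s) ∧
      (0 < T → ∃ a b v, a < b ∧ b ≤ T ∧ v ∈ F ∧ l (timeIn F ω a) = a ∧
        (∀ s, a ≤ s → s < b → ω s = v) ∧ ∀ s, b ≤ s → s < T → ω s ∉ F)) ?_ ?_ T
  · refine ⟨OrderIso.refl _, by simp [timeIn_zero], ?_, ?_, fun h => absurd h (lt_irrefl _)⟩
    · intro s hs
      simp_all [timeIn_zero]
    · intro s hs
      simp [timeIn_zero] at hs
  · rintro a' b' hab' ⟨l, hl, hbound, heq, hlast⟩ hconst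
    by_cases hF : ω a' ∈ F
    -- Inside `F` both clocks advance equally: continue with slope one, keeping the displacement.
    · obtain ⟨l', h1, h2⟩ := exists_glue l (timeIn F ω a') one_pos
      have hτ : timeIn F ω b' = timeIn F ω a' + (b' - a') :=
        timeIn_of_mem hab'.le fun s h3 h4 => by rwa [hconst s h3 h4]
      have hl' : ∀ s, timeIn F ω a' ≤ s → l' s = a' + (s - timeIn F ω a') := by
        intro s hs
        rw [h2 s hs, hl, one_mul]
      refine ⟨l', ?_, fun s hs => ?_, fun s hs => ?_, fun _ =>
        ⟨a', b', ω a', hab', le_rfl, hF, ?_, hconst, fun s h3 h4 => absurd h3 (not_le.2 h4)⟩⟩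
      · rw [hl' _ (hτ ▸ le_self_add), hτ, add_tsub_cancel_left, add_tsub_cancel_of_le hab'.le]
      · have hτ' : (timeIn F ω b' : ℝ) = timeIn F ω a' + (b' - a') := by
          rw [hτ, NNReal.coe_add, NNReal.coe_sub hab'.le]
        have e : (b' : ℝ) - timeIn F ω b' = a' - timeIn F ω a' := by rw [hτ']; ring
        rw [e]
        rcases le_total s (timeIn F ω a') with h | h
        · rw [h1 s h]
          exact hbound s h
        · have h3 := hbound _ le_rfl
          rw [hl] at h3
          rw [hl' s h, NNReal.coe_add, NNReal.coe_sub h]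
          constructor <;> linarith [h3.1]
      · rcases lt_or_ge s (timeIn F ω a') with h | h
        · rw [h1 s h.le]
          exact heq s h
        · have hlt : a' + (s - timeIn F ω a') < b' := by
            rw [hτ] at hs
            have := (tsub_lt_iff_left h).2 hs
            rwa [lt_tsub_iff_left] at this
          have hv := hconst _ le_self_add hlt
          rw [hl' s h, tracePath_of_mem hF hconst h hlt, lastVisit_eq_self (by rwa [hv]), hv]
      · rw [h1 _ le_rfl, hl]
    · have ha' : 0 < a' := by
        rw [pos_iff_ne_zero]
        rintro rfl
        exact hF h0
      obtain ⟨a, b, v, hab, hba', hv, hla, hcv, hout⟩ := hlast ha'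
      have hout' : ∀ s, b ≤ s → s < b' → ω s ∉ F := by
        intro s h3 h4
        rcases lt_or_ge s a' with h | h
        · exact hout s h3 h
        · rwa [hconst s h h4]
      have hab2 : a < b' := hab.trans (hba'.trans_lt hab')
      have hτ : timeIn F ω b = timeIn F ω a + (b - a) :=
        timeIn_of_mem hab.le fun s h3 h4 => by rwa [hcv s h3 h4]
      have hτ' : timeIn F ω b' = timeIn F ω a + (b - a) := by
        rw [timeIn_of_notMem (hba'.trans hab'.le) hout', hτ]
      have hτa' : timeIn F ω a' = timeIn F ω a + (b - a) := by
        rw [timeIn_of_notMem hba' hout, hτ]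
      have hpos : 0 < b - a := tsub_pos_of_lt hab
      -- Outside `F` the occupation clock stands still. Discard `l` beyond `timeIn F ω a` and
      -- stretch the holding interval, of length `b - a`, affinely over `[a, b']`.
      obtain ⟨l', h1, h2⟩ := exists_glue l (timeIn F ω a) (c := (b' - a) / (b - a))
        (div_pos (tsub_pos_of_lt hab2) hpos)
      have hlb' : l' (timeIn F ω b') = b' := by
        rw [h2 _ (hτ' ▸ le_self_add), hτ', add_tsub_cancel_left, div_mul_cancel₀ _ hpos.ne', hla,
          add_tsub_cancel_of_le hab2.le]
      have hba'R : (b : ℝ) ≤ a' := by exact_mod_cast hba'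
      have hab'R : (a' : ℝ) < b' := by exact_mod_cast hab'
      have habR : (0 : ℝ) < (b : ℝ) - a := sub_pos.2 (by exact_mod_cast hab)
      have hτR : (timeIn F ω b' : ℝ) = timeIn F ω a + (b - a) := by
        rw [hτ', NNReal.coe_add, NNReal.coe_sub hab.le]
      have hτR' : (timeIn F ω a' : ℝ) = timeIn F ω a + (b - a) := by
        rw [hτa', NNReal.coe_add, NNReal.coe_sub hab.le]
      have hba := hbound _ (hτa' ▸ le_self_add : timeIn F ω a ≤ timeIn F ω a')
      rw [hla] at hba
      refine ⟨l', hlb', fun s hs => ?_, fun s hs => ?_, fun _ =>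
        ⟨a, b, v, hab, hba'.trans hab'.le, hv, by rw [h1 _ le_rfl, hla], hcv, hout'⟩⟩
      · rcases le_total s (timeIn F ω a) with h | h
        · rw [h1 s h]
          have := hbound s (h.trans (hτa' ▸ le_self_add))
          exact ⟨this.1, by linarith [this.2]⟩
        · have hsR : (s : ℝ) ≤ timeIn F ω b' := by exact_mod_cast hs
          have hsR' : (timeIn F ω a : ℝ) ≤ s := by exact_mod_cast h
          have e : (l' s : ℝ) = a + ((b' : ℝ) - a) / (b - a) * (s - timeIn F ω a) := by
            rw [h2 s h, hla]
            push_cast [NNReal.coe_sub hab2.le, NNReal.coe_sub hab.le, NNReal.coe_sub h]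
            rfl
          -- The slope in excess of one adds at most `b' - b` to the displacement `a - timeIn F ω
          -- a`, for a total of `b' - timeIn F ω b'`.
          have e2 : ((b' : ℝ) - a) / (b - a) = 1 + (b' - b) / (b - a) := by
            field_simp
            ring
          set θ : ℝ := ((b' : ℝ) - b) / (b - a) with hθ
          have hθ0 : 0 ≤ θ := div_nonneg (by linarith) habR.le
          have hθ1 : θ * (b - a) = b' - b := div_mul_cancel₀ _ habR.ne'
          rw [e2, add_mul, one_mul] at e
          have g1 : 0 ≤ θ * (s - timeIn F ω a) := mul_nonneg hθ0 (by linarith)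
          have g2 : θ * (s - timeIn F ω a) ≤ θ * (b - a) :=
            mul_le_mul_of_nonneg_left (by linarith) hθ0
          constructor <;> linarith [hba.1, hba.2]
      · rcases lt_or_ge s (timeIn F ω a) with h | h
        · rw [h1 s h.le]
          exact heq s (h.trans_le (hτa' ▸ le_self_add))
        · have hlt : a + (s - timeIn F ω a) < b := by
            rw [hτ'] at hs
            have := (tsub_lt_iff_left h).2 hs
            rwa [lt_tsub_iff_left] at this
          rw [tracePath_of_mem hv hcv h hlt]
          have g1 : a ≤ l' s := by
            rw [h2 s h, hla]
            exact le_self_add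
          have g2 : l' s < b' := by
            rw [← hlb']
            exact l'.strictMono hs
          rcases lt_or_ge (l' s) b with h3 | h3
          · have := hcv _ g1 h3
            rw [lastVisit_eq_self (by rwa [this]), this]
          · exact lastVisit_eq_of_excursion hv hab h3 hcv fun r h4 h5 => hout' r h4 (h5.trans_lt g2)

/-- Near each `t` the trace is the last-visit path composed with an increasing homeomorphism.
Unboundedness of the clock provides a horizon `T` beyond any given `t`. -/
theorem isCadlag_tracePath {F : Set E} {ω : PathSpace E} (h0 : ω 0 ∈ F)
    (hω : ∀ t, ∃ T, t < timeIn F ω T) : IsCadlag (tracePath F ω) := by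
  refine ⟨fun t => ?_, fun t => ?_⟩
  all_goals
    obtain ⟨T, hT⟩ := hω t
    obtain ⟨l, -, -, heq⟩ := exists_timeChange h0 T
    have hev : tracePath F ω =ᶠ[𝓝 t] fun s => lastVisit F ω (l s) := by
      filter_upwards [Iio_mem_nhds hT] with s hs using (heq s hs).symm
  · have h1 := (isCadlag_lastVisit F ω).1 (l t)
    have h2 : ContinuousWithinAt (fun s => lastVisit F ω (l s)) (Ici t) t :=
      ContinuousWithinAt.comp (t := Ici (l t)) h1 l.continuous.continuousWithinAt
        fun u hu => l.monotone hu
    exact h2.congr_of_eventuallyEq (hev.filter_mono nhdsWithin_le_nhds) hev.self_of_nhds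
  · obtain ⟨v, hv⟩ := (isCadlag_lastVisit F ω).2 (l t)
    refine ⟨v, Tendsto.congr' (hev.filter_mono nhdsWithin_le_nhds).symm (hv.comp ?_)⟩
    refine tendsto_nhdsWithin_iff.2 ⟨(l.continuous.tendsto t).mono_left nhdsWithin_le_nhds, ?_⟩
    filter_upwards [self_mem_nhdsWithin] with u hu using l.strictMono hu

variable {κ : ℕ} [NeZero κ]

theorem lastVisitProcess_apply (𝓔 : Fin κ → Set E) (ω : PathSpace E) (t : ℝ≥0) :
    lastVisitProcess 𝓔 ω t = metaProj 𝓔 (lastVisit (⋃ x, 𝓔 x) ω t) :=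
  ofFun_apply ((isCadlag_lastVisit _ ω).comp_discrete _) t

/-- Less than one unit of time is lost before `M + 1`, so the clock has passed `M` by then and the
time change up to `M + 1` covers all of `[0, M]`. The hypothesis `hω` keeps `traceProcess` off the
default value of `ofFun`. -/
theorem traceProcess_lastVisitProcess_mem_closePairs {𝓔 : Fin κ → Set E} {ω : PathSpace E}
    (h0 : ω 0 ∈ ⋃ x, 𝓔 x) (hω : ∀ t, ∃ T, t < timeIn (⋃ x, 𝓔 x) ω T) {M : ℝ≥0} {ε : ℝ≥0}
    (hε : ε ≤ 1) (h : occupationTime (⋃ x, 𝓔 x)ᶜ (M + 1) ω < ε) :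
    (traceProcess 𝓔 ω, lastVisitProcess 𝓔 ω) ∈ closePairs (Fin κ) M ε := by
  rw [← coe_timeIn] at h
  have h' : timeIn (⋃ x, 𝓔 x)ᶜ ω (M + 1) < ε := by exact_mod_cast h
  have hadd : (timeIn (⋃ x, 𝓔 x) ω (M + 1) : ℝ) + timeIn (⋃ x, 𝓔 x)ᶜ ω (M + 1) = M + 1 := by
    exact_mod_cast timeIn_add_compl (⋃ x, 𝓔 x) ω (M + 1)
  have hR : (timeIn (⋃ x, 𝓔 x)ᶜ ω (M + 1) : ℝ) < ε := by exact_mod_cast h'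
  have hε' : (ε : ℝ) ≤ 1 := by exact_mod_cast hε
  have hM : M < timeIn (⋃ x, 𝓔 x) ω (M + 1) := by
    have : (M : ℝ) < timeIn (⋃ x, 𝓔 x) ω (M + 1) := by linarith
    exact_mod_cast this
  obtain ⟨l, -, hb, heq⟩ := exists_timeChange h0 (M + 1)
  refine ⟨l, fun t ht => ?_⟩
  obtain ⟨b1, b2⟩ := hb t (ht.trans hM.le)
  rw [NNReal.coe_add, NNReal.coe_one] at b2
  refine ⟨abs_lt.2 ⟨by linarith, by linarith⟩, ?_⟩
  have e : traceProcess 𝓔 ω t = metaProj 𝓔 (tracePath (⋃ x, 𝓔 x) ω t) :=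
    ofFun_apply ((isCadlag_tracePath h0 hω).comp_discrete _) t
  change lastVisitProcess 𝓔 ω (l t) = traceProcess 𝓔 ω t
  rw [lastVisitProcess_apply, e, heq t (ht.trans_lt hM)]

end timeChange

/-! ### Measurability of the last-visit process -/

section measurability

variable {E : Type*} [TopologicalSpace E] [DiscreteTopology E]

/-- Moving along the constancy intervals of the path, it suffices to remember the latest one in `F`.
-/
theorem exists_excursion {F : Set E} {ω : PathSpace E} (h0 : ω 0 ∈ F) {t : ℝ≥0} (ht : ω t ∉ F) :
    ∃ a b v, a < b ∧ b ≤ t ∧ v ∈ F ∧ (∀ s, a ≤ s → s < b → ω s = v) ∧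
      ∀ s, b ≤ s → s ≤ t → ω s ∉ F := by
  have key : 0 < t → ∃ a b v, a < b ∧ b ≤ t ∧ v ∈ F ∧ (∀ s, a ≤ s → s < b → ω s = v) ∧
      ∀ s, b ≤ s → s < t → ω s ∉ F := by
    refine cadlag_induction ω (p := fun t => 0 < t → ∃ a b v, a < b ∧ b ≤ t ∧ v ∈ F ∧
      (∀ s, a ≤ s → s < b → ω s = v) ∧ ∀ s, b ≤ s → s < t → ω s ∉ F)
      (fun h => absurd h (lt_irrefl _)) ?_ t
    intro a' b' hab' ih hconst _
    by_cases hF : ω a' ∈ F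
    · exact ⟨a', b', ω a', hab', le_rfl, hF, hconst, fun s h3 h4 => absurd h3 (not_le.2 h4)⟩
    · have ha' : 0 < a' := by
        rw [pos_iff_ne_zero]
        rintro rfl
        exact hF h0
      obtain ⟨a, b, v, hab, hba', hv, hcv, hout⟩ := ih ha'
      refine ⟨a, b, v, hab, hba'.trans hab'.le, hv, hcv, fun s h3 h4 => ?_⟩
      rcases lt_or_ge s a' with h | h
      · exact hout s h3 h
      · rwa [hconst s h h4]
  have ht0 : 0 < t := by
    rw [pos_iff_ne_zero]
    rintro rfl
    exact ht h0
  obtain ⟨a, b, v, hab, hbt, hv, hcv, hout⟩ := key ht0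
  refine ⟨a, b, v, hab, hbt, hv, hcv, fun s h1 h2 => ?_⟩
  rcases h2.eq_or_lt with rfl | h
  · exact ht
  · exact hout s h1 h

theorem lastVisit_mem {F : Set E} {ω : PathSpace E} (h0 : ω 0 ∈ F) (t : ℝ≥0) :
    lastVisit F ω t ∈ F := by
  by_cases ht : ω t ∈ F
  · rwa [lastVisit_eq_self ht]
  · obtain ⟨a, b, v, hab, hbt, hv, hcv, hout⟩ := exists_excursion h0 ht
    rwa [lastVisit_eq_of_excursion hv hab hbt hcv hout]

/-- With `D` countable, the right side is a countable combination of coordinate events. A dense set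
suffices because the last holding interval has positive length and so meets `D`, also to the right
of any candidate `q`. -/
theorem lastVisit_eq_iff {F : Set E} {ω : PathSpace E} (h0 : ω 0 ∈ F) {D : Set ℝ≥0}
    (hD : Dense D) (t : ℝ≥0) {v : E} (hv : v ∈ F) :
    lastVisit F ω t = v ↔ ω t = v ∨ (ω t ∉ F ∧
      ∃ q ∈ D, q < t ∧ ω q = v ∧ ∀ r ∈ D, q < r → r < t → ω r ∉ F ∨ ω r = v) := by
  by_cases ht : ω t ∈ F
  · simp [lastVisit_eq_self ht, ht]
  · obtain ⟨a, b, w, hab, hbt, hw, hcw, hout⟩ := exists_excursion h0 ht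
    rw [lastVisit_eq_of_excursion hw hab hbt hcw hout]
    have hne : ω t ≠ v := fun h => ht (h ▸ hv)
    simp only [hne, false_or, ht, not_false_eq_true, true_and]
    constructor
    · rintro rfl
      obtain ⟨q, hqD, hq⟩ := hD.exists_between hab
      refine ⟨q, hqD, hq.2.trans_le hbt, hcw q hq.1.le hq.2, fun r _ h1 h2 => ?_⟩
      rcases lt_or_ge r b with h | h
      · exact Or.inr (hcw r (hq.1.trans h1).le h)
      · exact Or.inl (hout r h h2.le)
    · rintro ⟨q, -, hqt, hqv, hr⟩
      have hqb : q < b := by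
        by_contra! h
        exact hout q h hqt.le (hqv ▸ hv)
      obtain ⟨r, hrD, hr1, hr2⟩ := hD.exists_between (max_lt hab hqb)
      have e := hcw r ((le_max_left _ _).trans hr1.le) hr2
      rcases hr r hrD ((le_max_right _ _).trans_lt hr1) (hr2.trans_le hbt) with h | h
      · exact absurd (e ▸ hw) h
      · rw [← e, h]

theorem PathSpace.measurable_of_eval {Ω E' : Type*} [MeasurableSpace Ω] [TopologicalSpace E']
    {Y : Ω → PathSpace E'} (h : ∀ t (s : Set E'), MeasurableSet {a | Y a t ∈ s}) :
    Measurable Y := by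
  refine measurable_iff_comap_le.2 ?_
  rw [instMeasurableSpace, MeasurableSpace.comap_iSup]
  refine iSup_le fun t => ?_
  rw [MeasurableSpace.comap_comp]
  rintro _ ⟨s, -, rfl⟩
  exact h t s

variable {κ : ℕ} [NeZero κ]

theorem aemeasurable_lastVisitProcess [Countable E] (𝓔 : Fin κ → Set E)
    {μ : Measure (PathSpace E)} (h0 : ∀ᵐ ω ∂μ, ω 0 ∈ ⋃ x, 𝓔 x) :
    AEMeasurable (lastVisitProcess 𝓔) μ := by
  classical
  set F := ⋃ x, 𝓔 x with hF
  obtain ⟨D, hDc, hD⟩ := TopologicalSpace.exists_countable_dense ℝ≥0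
  have hm0 : MeasurableSet {ω : PathSpace E | ω 0 ∈ F} := measurableSet_eval 0 F
  -- The description of last visits needs a start in `F`; on the null set of other starts a constant
  -- path is used.
  let Y : PathSpace E → PathSpace (Fin κ) := fun ω =>
    if ω 0 ∈ F then lastVisitProcess 𝓔 ω else ofFun fun _ => 0
  have hY1 : ∀ ω : PathSpace E, ω 0 ∈ F → Y ω = lastVisitProcess 𝓔 ω := fun ω h => if_pos h
  have hY0 : ∀ ω : PathSpace E, ω 0 ∉ F → ∀ t, Y ω t = 0 := by
    intro ω h t
    have : Y ω = ofFun fun _ => 0 := if_neg h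
    rw [this, ofFun_apply (isCadlag_const 0)]
  refine ⟨Y, PathSpace.measurable_of_eval fun t s => ?_, ?_⟩
  · let A : E → Set (PathSpace E) := fun v => {ω | ω t ∈ ({v} : Set E)} ∪
      ({ω | ω t ∈ Fᶜ} ∩ ⋃ q ∈ D ∩ Iio t, {ω | ω q ∈ ({v} : Set E)} ∩
        ⋂ r ∈ D ∩ Ioo q t, {ω | ω r ∈ Fᶜ ∪ {v}})
    have hA : ∀ v, MeasurableSet (A v) := by
      intro v
      refine (measurableSet_eval _ _).union ((measurableSet_eval _ _).inter ?_)
      refine MeasurableSet.biUnion (hDc.mono inter_subset_left) fun q _ => ?_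
      refine (measurableSet_eval _ _).inter ?_
      exact MeasurableSet.biInter (hDc.mono inter_subset_left) fun r _ => measurableSet_eval _ _
    have hA' : ∀ v ∈ F, ∀ ω : PathSpace E, ω 0 ∈ F → (ω ∈ A v ↔ lastVisit F ω t = v) := by
      intro v hv ω h
      rw [lastVisit_eq_iff h hD t hv]
      simp only [A, mem_union, mem_inter_iff, mem_iUnion, mem_iInter, mem_ofPred_eq, mem_compl_iff,
        mem_singleton_iff, mem_Iio, mem_Ioo, exists_prop, and_assoc, and_imp]
    have : {ω : PathSpace E | Y ω t ∈ s} =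
        ({ω | ω 0 ∈ F} ∩ ⋃ v ∈ F ∩ metaProj 𝓔 ⁻¹' s, A v) ∪
          ({ω | ω 0 ∈ F}ᶜ ∩ {_ω | (0 : Fin κ) ∈ s}) := by
      ext ω
      by_cases h : ω 0 ∈ F
      · have e : Y ω t = metaProj 𝓔 (lastVisit F ω t) := by
          rw [hY1 ω h]
          exact lastVisitProcess_apply 𝓔 ω t
        simp only [mem_ofPred_eq, h, e, mem_union, mem_inter_iff, mem_compl_iff,
          mem_iUnion, exists_prop, true_and, not_true_eq_false, false_and, or_false, mem_preimage]
        constructor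
        · exact fun hs => ⟨_, ⟨lastVisit_mem h t, hs⟩, (hA' _ (lastVisit_mem h t) ω h).2 rfl⟩
        · rintro ⟨v, ⟨hv, hs⟩, hvA⟩
          rwa [(hA' v hv ω h).1 hvA]
      · simp [h, hY0 ω h]
    rw [this]
    refine (hm0.inter ?_).union (hm0.compl.inter (MeasurableSet.const _))
    exact MeasurableSet.biUnion (to_countable _) fun v _ => hA v
  · filter_upwards [h0] with ω h
    rw [hY1 ω h]

end measurability

/-! ### Irreducible chains spend an infinite time in every nonempty set -/

section recurrence

variable {E : Type*} [TopologicalSpace E] [DiscreteTopology E]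
  {P : E → ProbabilityMeasure (PathSpace E)}

/-- The one-point case of the Markov property. -/
theorem IsMarkovProcess.measure_inter_shift (hP : IsMarkovProcess P) (x y : E) (s : ℝ≥0)
    {B : Set (PathSpace E)} (hB : MeasurableSet B) :
    (P x : Measure (PathSpace E)) ({ω | ω s = y} ∩ shift s ⁻¹' B) =
      (P y : Measure (PathSpace E)) B * (P x : Measure (PathSpace E)) {ω | ω s = y} := by
  have hA : MeasurableSet[past E s] {ω : PathSpace E | ω s = y} := by
    refine (le_iSup₂ (f := fun (r : ℝ≥0) (_ : r ≤ s) =>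
      (borel E).comap (fun ω : PathSpace E => ω r)) s le_rfl) _ ?_
    exact ⟨{y}, by rw [borel_eq_top_of_discrete]; trivial, rfl⟩
  rw [hP.markov x s _ B hA hB, ← setLIntegral_const]
  refine setLIntegral_congr_fun (measurableSet_eval s {y}) fun ω hω => ?_
  have : ω s = y := hω
  simp only [this]

theorem IsMarkovProcess.exists_pos_trans (hP : IsMarkovProcess P) {x y z : E}
    (h1 : ∃ s, 0 < (P x : Measure (PathSpace E)) {ω | ω s = y})
    (h2 : ∃ s, 0 < (P y : Measure (PathSpace E)) {ω | ω s = z}) :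
    ∃ s, 0 < (P x : Measure (PathSpace E)) {ω | ω s = z} := by
  obtain ⟨s, hs⟩ := h1
  obtain ⟨t, ht⟩ := h2
  refine ⟨s + t, ?_⟩
  have h := hP.measure_inter_shift x y s (B := {ω | ω t = z}) (measurableSet_eval t {z})
  have hsub : {ω : PathSpace E | ω s = y} ∩ shift s ⁻¹' {ω | ω t = z} ⊆ {ω | ω (s + t) = z} :=
    inter_subset_right
  refine lt_of_lt_of_le ?_ (measure_mono hsub)
  rw [h]
  exact ENNReal.mul_pos ht.ne' hs.ne'

omit [DiscreteTopology E] in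
-- Otherwise the expectation of the indicator of `y` would vanish at all times, whereas the
-- generator gives it derivative `R x y` at time zero.
theorem exists_pos_of_rate [Fintype E] {R : E → E → ℝ≥0} (hPR : HasJumpRates R P) {x y : E}
    (hxy : x ≠ y) (h : 0 < R x y) : ∃ s, 0 < (P x : Measure (PathSpace E)) {ω | ω s = y} := by
  classical
  by_contra! hcon
  have hd := hPR (fun z => if z = y then 1 else 0) x
  have hz : ∀ t : ℝ, ∫ ω, (if ω t.toNNReal = y then (1 : ℝ) else 0)
      ∂(P x : Measure (PathSpace E)) = 0 := by
    intro t
    refine integral_eq_zero_of_ae ?_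
    have : ∀ᵐ ω ∂(P x : Measure (PathSpace E)), ω t.toNNReal ≠ y := by
      rw [ae_iff]
      simpa using hcon t.toNNReal
    filter_upwards [this] with ω hω
    simp [hω]
  have hs : ∑ ξ, ((if ξ = y then (1 : ℝ) else 0) - if x = y then 1 else 0) * (R x ξ : ℝ) =
      R x y := by
    simp [hxy]
  simp only [hz, hs] at hd
  have h0 := (uniqueDiffWithinAt_Ici (0 : ℝ)).eq_deriv _ hd (hasDerivWithinAt_const _ _ _)
  exact h.ne' (by exact_mod_cast h0)

theorem exists_pos_of_irreducible [Fintype E] {R : E → E → ℝ≥0} (hR : IsIrreducibleRates R)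
    (hP : IsMarkovProcess P) (hPR : HasJumpRates R P) (x y : E) :
    ∃ s, 0 < (P x : Measure (PathSpace E)) {ω | ω s = y} := by
  have hrefl : ∀ x : E, ∃ s, 0 < (P x : Measure (PathSpace E)) {ω | ω s = x} := by
    intro x
    refine ⟨0, ?_⟩
    have : (P x : Measure (PathSpace E)) {ω | ω 0 = x} = 1 :=
      prob_compl_eq_zero_iff (measurableSet_eval 0 {x}) |>.1 (hP.start x)
    rw [this]
    exact one_pos
  induction hR x y with
  | refl => exact hrefl x
  | @tail b c _ hbc ih =>
    -- Diagonal rates may be positive but do not enter the generator.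
    rcases eq_or_ne b c with rfl | hne
    · exact ih
    · exact hP.exists_pos_trans ih (exists_pos_of_rate hPR hne hbc)

/-- A path at `y` stays there for a positive time. One integer `n` serves as both horizon and
inverse threshold, so that the events increase to that of positive occupation. -/
theorem exists_occupationTime_pos {F : Set E} {x y : E} (hy : y ∈ F)
    (h : ∃ s, 0 < (P x : Measure (PathSpace E)) {ω | ω s = y}) :
    ∃ n : ℕ, 0 < (P x : Measure (PathSpace E)) {ω | 1 / ((n : ℝ≥0∞) + 1) ≤ occupationTime F n ω} := by
  obtain ⟨s, hs⟩ := h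
  by_contra! hcon
  refine hs.not_ge (le_of_le_of_eq (measure_mono fun ω hω => ?_)
    (measure_iUnion_null fun n => le_zero_iff.1 (hcon n)))
  have hω' : ω s = y := hω
  obtain ⟨c, hc, hconst⟩ := ω.exists_eq_right s
  have hpos : 0 < occupationTime F c ω := by
    rw [occupationTime_of_mem hc.le fun r h1 h2 => by rw [hconst r h1 h2, hω']; exact hy]
    refine lt_of_lt_of_le ?_ le_add_self
    exact_mod_cast tsub_pos_of_lt hc
  obtain ⟨m, hm⟩ := ENNReal.exists_inv_nat_lt hpos.ne'
  obtain ⟨k, hk⟩ := exists_nat_ge c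
  refine mem_iUnion.2 ⟨max m k, ?_⟩
  have h1 : occupationTime F c ω ≤ occupationTime F ((max m k : ℕ) : ℝ≥0) ω :=
    occupationTime_mono F ω (hk.trans (by exact_mod_cast le_max_right m k))
  refine le_trans ?_ (hm.le.trans h1)
  rw [one_div]
  refine ENNReal.inv_le_inv.2 ?_
  exact (by exact_mod_cast le_max_left m k : (m : ℝ≥0∞) ≤ (max m k : ℕ)).trans le_self_add

omit [DiscreteTopology E] in
theorem exists_unif_occupationTime [Finite E] {F : Set E}
    (h : ∀ x, ∃ n : ℕ, 0 < (P x : Measure (PathSpace E))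
      {ω | 1 / ((n : ℝ≥0∞) + 1) ≤ occupationTime F n ω}) :
    ∃ n : ℕ, ∀ x, 0 < (P x : Measure (PathSpace E))
      {ω | 1 / ((n : ℝ≥0∞) + 1) ≤ occupationTime F n ω} := by
  choose n hn using h
  obtain ⟨m, hm⟩ := Finite.exists_le n
  refine ⟨m, fun x => (hn x).trans_le (measure_mono fun ω hω => ?_)⟩
  have hω' : 1 / ((n x : ℝ≥0∞) + 1) ≤ occupationTime F (n x) ω := hω
  refine le_trans (ENNReal.div_le_div_left ?_ _) (hω'.trans (occupationTime_mono F ω ?_))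
  · gcongr
    exact_mod_cast hm x
  · exact_mod_cast hm x

/-- Let `z` maximise the probability of `C`. On `C`, the path has occupation below `δ` up to `n` and
its shift by `n` is again in `C`. The Markov property gives `P z C ≤ P z C * P z A` with `P z A <
1`, so the maximum is zero. -/
theorem measure_occupationTime_lt_eq_zero [Finite E] (hP : IsMarkovProcess P) {F : Set E} {n : ℕ}
    {δ : ℝ≥0∞} (h : ∀ x, 0 < (P x : Measure (PathSpace E)) {ω | δ ≤ occupationTime F n ω}) (x : E) :
    (P x : Measure (PathSpace E)) {ω | ∀ m : ℕ, occupationTime F m ω < δ} = 0 := by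
  have : Nonempty E := ⟨x⟩
  set C : Set (PathSpace E) := {ω | ∀ m : ℕ, occupationTime F m ω < δ} with hC
  have hCm : MeasurableSet C := by
    rw [hC, ofPred_forall]
    exact MeasurableSet.iInter fun m => measurableSet_lt (measurable_occupationTime F m)
      measurable_const
  set A : Set (PathSpace E) := {ω | occupationTime F n ω < δ} with hA
  have hAp : MeasurableSet[past E n] A :=
    measurable_past_occupationTime F n measurableSet_Iio
  have hAm : MeasurableSet A := measurableSet_lt (measurable_occupationTime F n) measurable_const
  have hA1 : ∀ y, (P y : Measure (PathSpace E)) A < 1 := by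
    intro y
    have : A = {ω | δ ≤ occupationTime F n ω}ᶜ := by
      ext ω
      simp [hA]
    rw [this, prob_compl_eq_one_sub
      (measurableSet_le measurable_const (measurable_occupationTime F n))]
    exact ENNReal.sub_lt_self ENNReal.one_ne_top one_ne_zero (h y).ne'
  obtain ⟨z, hz⟩ := Finite.exists_max fun y => (P y : Measure (PathSpace E)) C
  have hsub : C ⊆ A ∩ shift n ⁻¹' C := by
    refine fun ω hω => ⟨hω n, fun m => lt_of_le_of_lt ?_ (hω (n + m))⟩
    rw [Nat.cast_add, occupationTime_add]
    exact le_add_self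
  have hle : (P z : Measure (PathSpace E)) C ≤
      (P z : Measure (PathSpace E)) C * (P z : Measure (PathSpace E)) A := by
    calc (P z : Measure (PathSpace E)) C
        ≤ (P z : Measure (PathSpace E)) (A ∩ shift n ⁻¹' C) := measure_mono hsub
      _ = ∫⁻ ω in A, (P (ω n) : Measure (PathSpace E)) C ∂(P z : Measure (PathSpace E)) :=
        hP.markov z n A C hAp hCm
      _ ≤ ∫⁻ _ω in A, (P z : Measure (PathSpace E)) C ∂(P z : Measure (PathSpace E)) :=
        lintegral_mono fun ω => hz _
      _ = _ := setLIntegral_const _ _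
  have hz0 : (P z : Measure (PathSpace E)) C = 0 := by
    by_contra hne
    have := ENNReal.mul_lt_mul_right hne (measure_ne_top _ _) (hA1 z)
    rw [mul_one] at this
    exact absurd hle (not_le.2 this)
  exact le_zero_iff.1 ((hz x).trans_eq hz0)

theorem ae_exists_lt_timeIn [Fintype E] {R : E → E → ℝ≥0} (hR : IsIrreducibleRates R)
    (hP : IsMarkovProcess P) (hPR : HasJumpRates R P) {F : Set E} (hF : F.Nonempty) (x : E) :
    ∀ᵐ ω ∂(P x : Measure (PathSpace E)), ∀ t, ∃ T, t < timeIn F ω T := by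
  obtain ⟨y, hy⟩ := hF
  obtain ⟨n, hn⟩ := exists_unif_occupationTime (P := P) (F := F) fun x =>
    exists_occupationTime_pos hy (exists_pos_of_irreducible hR hP hPR x y)
  set δ : ℝ≥0∞ := 1 / ((n : ℝ≥0∞) + 1) with hδ
  have hnull := measure_occupationTime_lt_eq_zero hP hn
  set C : Set (PathSpace E) := {ω | ∀ m : ℕ, occupationTime F m ω < δ} with hC
  have hCm : MeasurableSet C := by
    rw [hC, ofPred_forall]
    exact MeasurableSet.iInter fun m => measurableSet_lt (measurable_occupationTime F m)
      measurable_const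
  -- After every integer time, `F` still receives at least `δ` more time; repeating this makes the
  -- clock unbounded.
  have hshift : ∀ᵐ ω ∂(P x : Measure (PathSpace E)), ∀ m : ℕ, shift m ω ∉ C := by
    refine ae_all_iff.2 fun m => ?_
    have h := hP.markov x m univ C MeasurableSet.univ hCm
    simp only [hnull, univ_inter, lintegral_zero] at h
    exact measure_eq_zero_iff_ae_notMem.1 h
  filter_upwards [hshift] with ω hω t
  have key : ∀ k : ℕ, ∃ m : ℕ, k * δ ≤ occupationTime F m ω := by
    intro k
    induction k with
    | zero => exact ⟨0, by simp⟩
    | succ k ih =>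
      obtain ⟨m, hm⟩ := ih
      have hnot := hω m
      simp only [hC, mem_ofPred_eq, not_forall, not_lt] at hnot
      obtain ⟨j, hj⟩ := hnot
      refine ⟨m + j, ?_⟩
      rw [Nat.cast_add, Nat.cast_add, occupationTime_add, add_mul, Nat.cast_one, one_mul]
      exact add_le_add hm hj
  have hδ0 : δ ≠ 0 := by simp [hδ, ENNReal.add_eq_top]
  obtain ⟨k, hk⟩ := ENNReal.exists_nat_mul_gt hδ0 (ENNReal.coe_ne_top (r := t))
  obtain ⟨m, hm⟩ := key k
  refine ⟨m, ?_⟩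
  have := hk.trans_le hm
  rw [← coe_timeIn] at this
  exact_mod_cast this

end recurrence

/-! ### Convergence together -/

/-- If `X n` converges in distribution and the probability that `(X n, Y n)` lies outside of any
given entourage tends to zero, then `Y n` has the same limit. -/
theorem MeasureTheory.TendstoInDistribution.of_tendsto_measure_notMem_entourage {S : Type*}
    [UniformSpace S] [(𝓤 S).IsCountablyGenerated] [MeasurableSpace S] [OpensMeasurableSpace S]
    {Ω : ℕ → Type*} [∀ n, MeasurableSpace (Ω n)] {μ : ∀ n, Measure (Ω n)}
    [∀ n, IsProbabilityMeasure (μ n)] {Ω' : Type*} [MeasurableSpace Ω'] {ν : Measure Ω'}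
    [IsProbabilityMeasure ν] {X Y : ∀ n, Ω n → S} {Z : Ω' → S}
    (hX : TendstoInDistribution X atTop Z μ ν) (hY : ∀ n, AEMeasurable (Y n) (μ n))
    (h : ∀ V ∈ 𝓤 S, Tendsto (fun n => μ n {ω | (X n ω, Y n ω) ∉ V}) atTop (𝓝 0)) :
    TendstoInDistribution Y atTop Z μ ν := by
  refine ⟨hY, hX.aemeasurable_limit, tendsto_of_forall_isOpen_le_liminf' fun G hG => ?_⟩
  let _ : PseudoMetricSpace S := UniformSpace.pseudoMetricSpace S
  -- These open sets exhaust `G` and leave a margin: if `X n` is in `G' k` and `Y n` is not in `G`,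
  -- the two are at least that margin apart.
  let G' : ℕ → Set S := fun k => {x | ((k : ℝ≥0∞) + 1)⁻¹ < Metric.infEDist x Gᶜ}
  have hG' : ∀ k, IsOpen (G' k) := fun k => isOpen_lt continuous_const Metric.continuous_infEDist
  have hsub : ∀ k, G' k ⊆ G := by
    intro k x hx
    by_contra hxG
    have hx' : ((k : ℝ≥0∞) + 1)⁻¹ < Metric.infEDist x Gᶜ := hx
    rw [Metric.infEDist_zero_of_mem hxG] at hx'
    exact not_lt_zero hx'
  have hmono : Monotone G' := by
    intro j k hjk x hx
    refine lt_of_le_of_lt (ENNReal.inv_le_inv.2 ?_) (show _ < Metric.infEDist x Gᶜ from hx)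
    gcongr
  have hunion : ⋃ k, G' k = G := by
    refine (iUnion_subset hsub).antisymm fun x hx => ?_
    have hpos : Metric.infEDist x Gᶜ ≠ 0 := by
      intro h0
      exact (Metric.mem_iff_infEDist_zero_of_closed hG.isClosed_compl).2 h0 hx
    obtain ⟨k, hk⟩ := ENNReal.exists_inv_nat_lt hpos
    exact mem_iUnion.2 ⟨k, (ENNReal.inv_le_inv.2 le_self_add).trans_lt hk⟩
  change (ν.map Z) G ≤ liminf (fun n => ((μ n).map (Y n)) G) atTop
  rw [← hunion, hmono.measure_iUnion, hunion]
  refine iSup_le fun k => ?_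
  have h1 := ProbabilityMeasure.le_liminf_measure_open_of_tendsto hX.tendsto (hG' k)
  change (ν.map Z) (G' k) ≤ liminf (fun n => ((μ n).map (X n)) (G' k)) atTop at h1
  have hV : {p : S × S | edist p.1 p.2 < ((k : ℝ≥0∞) + 1)⁻¹} ∈ 𝓤 S :=
    edist_mem_uniformity (ENNReal.inv_pos.2 (by simp [ENNReal.add_eq_top]))
  refine h1.trans ?_
  -- The probability that the pair is far apart tends to zero, so it can be added inside the liminf.
  rw [← ENNReal.liminf_add_of_right_tendsto_zero (h _ hV) fun n => ((μ n).map (Y n)) G]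
  refine liminf_le_liminf (Eventually.of_forall fun n => ?_)
  rw [Pi.add_apply, Measure.map_apply_of_aemeasurable (hX.forall_aemeasurable n) (hG' k).measurableSet,
    Measure.map_apply_of_aemeasurable (hY n) hG.measurableSet]
  refine (measure_mono fun ω hω => ?_).trans (measure_union_le _ _)
  by_cases hYG : Y n ω ∈ G
  · exact Or.inl hYG
  · refine Or.inr fun hlt => ?_
    have hω' : ((k : ℝ≥0∞) + 1)⁻¹ < Metric.infEDist (X n ω) Gᶜ := hω
    exact absurd (hω'.trans_le (Metric.infEDist_le_edist_of_mem hYG)) (not_lt.2 (le_of_lt hlt))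

/-! ### Convergence of the last-visit process -/

theorem mainTheorem5 {κ : ℕ} [NeZero κ] {E : ℕ → Type*} [∀ N, Fintype (E N)]
    [∀ N, TopologicalSpace (E N)] [∀ N, DiscreteTopology (E N)]
    (R : ∀ N, E N → E N → ℝ≥0) (hR : ∀ N, IsIrreducibleRates (R N))
    (P : ∀ N, E N → ProbabilityMeasure (PathSpace (E N)))
    (hP : ∀ N, IsMarkovProcess (P N)) (hPR : ∀ N, HasJumpRates (R N) (P N))
    (𝓔 : ∀ N, Fin κ → Set (E N)) (h𝓔 : ∀ N x y, x ≠ y → Disjoint (𝓔 N x) (𝓔 N y))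
    (Q : Fin κ → ProbabilityMeasure (PathSpace (Fin κ)))
    (hmeta : IsMetastable P 𝓔 Q)
    (x : Fin κ) (η : ∀ N, E N) (hη : ∀ N, η N ∈ 𝓔 N x) :
    TendstoInDistribution (fun N => lastVisitProcess (𝓔 N)) atTop id
      (fun N => (P N (η N) : Measure (PathSpace (E N))))
      (Q x : Measure (PathSpace (Fin κ))) := by
  have hmem : ∀ N, η N ∈ ⋃ y, 𝓔 N y := fun N => mem_iUnion.2 ⟨x, hη N⟩
  have h0 : ∀ N, ∀ᵐ ω ∂(P N (η N) : Measure (PathSpace (E N))), ω 0 ∈ ⋃ y, 𝓔 N y := by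
    intro N
    filter_upwards [(hP N).start (η N)] with ω hω
    rw [hω]
    exact hmem N
  refine (hmeta.tendsto_trace x η hη).of_tendsto_measure_notMem_entourage
    (fun N => aemeasurable_lastVisitProcess (𝓔 N) (h0 N)) fun V hV => ?_
  obtain ⟨⟨M, ε⟩, hε, hMV⟩ := hasBasis_uniformity.mem_iff.1 hV
  set δ : ℝ≥0 := min ε.toNNReal 1 with hδ
  have hδ0 : 0 < δ := lt_min (Real.toNNReal_pos.2 hε) one_pos
  have hδε : (δ : ℝ) ≤ ε :=
    (NNReal.coe_le_coe.2 (min_le_left _ _)).trans_eq (Real.coe_toNNReal _ (le_of_lt hε))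
  -- Markov's inequality will bound the bad event by the worst expected time outside up to `M + 1`,
  -- divided by `δ`.
  have hlim := ENNReal.Tendsto.div_const
    (hmeta.tendsto_occupationTime (M + 1) (by positivity)) (b := (δ : ℝ≥0∞))
    (Or.inr (by exact_mod_cast hδ0.ne'))
  rw [ENNReal.zero_div] at hlim
  refine tendsto_of_tendsto_of_tendsto_of_le_of_le tendsto_const_nhds hlim (fun _ => zero_le)
    fun N => ?_
  have hbad : ∀ᵐ ω ∂(P N (η N) : Measure (PathSpace (E N))),
      ω ∈ {ω | (traceProcess (𝓔 N) ω, lastVisitProcess (𝓔 N) ω) ∉ V} →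
        ω ∈ {ω | (δ : ℝ≥0∞) ≤ occupationTime (⋃ y, 𝓔 N y)ᶜ (M + 1) ω} := by
    filter_upwards [h0 N, ae_exists_lt_timeIn (hR N) (hP N) (hPR N) ⟨_, hmem N⟩ (η N)]
      with ω h1 h2 hV'
    by_contra hlt
    exact hV' (hMV (closePairs_mono le_rfl hδε
      (traceProcess_lastVisitProcess_mem_closePairs h1 h2 (min_le_right _ _) (not_le.1 hlt))))
  refine (measure_mono_ae hbad).trans ?_
  refine (meas_ge_le_lintegral_div (measurable_occupationTime _ _).aemeasurable
    (by exact_mod_cast hδ0.ne') ENNReal.coe_ne_top).trans ?_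
  refine ENNReal.div_le_div_right ?_ _
  exact le_iSup₂ (f := fun ξ (_ : ξ ∈ ⋃ y, 𝓔 N y) => ∫⁻ ω, occupationTime (⋃ y, 𝓔 N y)ᶜ (M + 1) ω
    ∂(P N ξ : Measure (PathSpace (E N)))) (η N) (hmem N)
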